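/- Let $V$ be a finite-dimensional Euclidean vector space and let $W\subset \mathrm{O}(V)$ be a finite reflection group that is almost irreducible, i.e. $V=V_1\oplus V_2$ with $W$-invariant subspaces such that $W$ acts irreducibly and nontrivially on $V_1$, trivially on $V_2$, and $\dim V_2=1$. Let $\Gamma\subset V$ be a $W$-invariant lattice (of full rank). Let $C$ be a monoconditional symmetric cone, i.e. $C=\{x\in V : \langle\sigma x,\psi\rangle\ge 0 \text{ for all } \sigma\in W\}$ for some linear form $\psi\in V^*$ with $V_1,V_2\not\subset\ker\psi$. Let $F\subset V$ be a fundamental domain for $W$ (the closure of an open set that meets each $W$-orbit in exactly one point), let $H_1,\dots,H_{n-1}$ be its distinct facet hyperplanes, listed in any order, and let $s_j$ be the orthogonal reflection at $H_j$. For $\sigma\in W$ let $l(\sigma)$ be the smallest length of a word in $s_1,\dots,s_{n-1}$ with product $\sigma$, and let $\mathrm{Des}_R(\sigma)=\{j : l(\sigma s_j)<l(\sigma)\}$. Suppose that $C_+=C\cap F$ is unimodular with respect to $\Gamma$, i.e. it is the cone generated by a $\mathbf{Z}$-basis of $\Gamma$; the elements of such a basis are called primitive generators of $C_+$. Then $n=\dim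 V$, and there is a unique enumeration $b_1,\dots,b_n$ of the primitive generators of $C_+$ such that $b_j\notin H_j$ for $1\le j\le n-1$. Moreover, the generating function of $C$ with respect to $\Gamma$ is $$f_C(\varphi)=\sum_{\sigma\in W}\frac{\prod_{j\in \mathrm{Des}_R(\sigma)}e^{-\langle\sigma b_j,\varphi\rangle}}{\prod_{j=1}^n\bigl(1-e^{-\langle\sigma b_j,\varphi\rangle}\bigr)}.$$ That is, the right-hand side is a meromorphic function of $\varphi\in V^*_{\mathbf C}=V^*\otimes_{\mathbf R}\mathbf C$, and on some nonempty open subset of $V^*_{\mathbf C}$ the series $\sum_{x\in C\cap\Gamma}e^{-\langle x,\varphi\rangle}$ converges to it. -/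

import Mathlib

namespace SymCone

noncomputable section

section Groups

variable {V : Type*} [NormedAddCommGroup V] [InnerProductSpace ℝ V]

/-- A linear subspace is invariant under `W`. -/
def IsInvariant (W : Subgroup (V ≃ₗᵢ[ℝ] V)) (U : Submodule ℝ V) : Prop :=
  ∀ σ ∈ W, ∀ x ∈ U, σ x ∈ U

/-- An element of the orthogonal group `O(V)` that is the reflection at the hyperplane orthogonal
to some nonzero vector. -/
def IsHyperplaneReflection (s : V ≃ₗᵢ[ℝ] V) : Prop :=
  ∃ v : V, v ≠ 0 ∧ s = (ℝ ∙ v)ᗮ.reflection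

/-- A subgroup of the orthogonal group that is generated by the hyperplane reflections it
contains. -/
def IsReflectionGroup (W : Subgroup (V ≃ₗᵢ[ℝ] V)) : Prop :=
  Subgroup.closure {s | s ∈ W ∧ IsHyperplaneReflection s} = W

/-- `V = V₁ ⊕ V₂` with `W`-invariant summands, where `W` acts irreducibly and nontrivially on `V₁`
and trivially on the one-dimensional space `V₂`. -/
structure IsAlmostIrreducible (W : Subgroup (V ≃ₗᵢ[ℝ] V)) (V₁ V₂ : Submodule ℝ V) : Prop where
  isCompl : IsCompl V₁ V₂
  invariant : IsInvariant W V₁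
  irreducible : ∀ U : Submodule ℝ V, U ≤ V₁ → IsInvariant W U → U = ⊥ ∨ U = V₁
  nontrivial : ∃ σ ∈ W, ∃ x ∈ V₁, σ x ≠ x
  trivial : ∀ σ ∈ W, ∀ x ∈ V₂, σ x = x
  finrank_eq_one : Module.finrank ℝ V₂ = 1

/-- `C` is a monoconditional symmetric cone. Since `W` is finite, the set on the right-hand side
is automatically a `W`-invariant convex polyhedral cone. -/
def IsMonoconditional (W : Subgroup (V ≃ₗᵢ[ℝ] V)) (V₁ V₂ : Submodule ℝ V) (C : Set V) : Prop :=
  ∃ φ : Module.Dual ℝ V, ¬ V₁ ≤ LinearMap.ker φ ∧ ¬ V₂ ≤ LinearMap.ker φ ∧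
    C = {x | ∀ σ ∈ W, 0 ≤ φ (σ x)}

/-- `F` is the closure of an open set and meets each `W`-orbit in exactly one point. -/
def IsFundamentalDomain (W : Subgroup (V ≃ₗᵢ[ℝ] V)) (F : Set V) : Prop :=
  (∃ U : Set V, IsOpen U ∧ F = closure U) ∧
    ∀ x : V, ∃! y : V, y ∈ F ∧ ∃ σ ∈ W, σ x = y

/-- `H` is a facet hyperplane of the cone `F`: it is a linear hyperplane, `F` lies on one side of
it, and the face `F ∩ H` spans `H`. -/
def IsFacetHyperplane (F : Set V) (H : Submodule ℝ V) : Prop :=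
  (∃ α : Module.Dual ℝ V, α ≠ 0 ∧ LinearMap.ker α = H ∧ ∀ x ∈ F, 0 ≤ α x) ∧
    Submodule.span ℝ (F ∩ (H : Set V)) = H

end Groups

section Descents

variable {G : Type*} [Group G] {r : ℕ}

/-- The smallest length of a word in the generators `s` whose product is `g`. -/
def wordLength (s : Fin r → G) (g : G) : ℕ :=
  sInf {k | ∃ w : List (Fin r), w.length = k ∧ (w.map s).prod = g}

/-- The right descent set. -/
def rightDescents (s : Fin r → G) (g : G) : Finset (Fin r) :=
  Finset.univ.filter fun j => wordLength s (g * s j) < wordLength s g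

end Descents

section Lattice

variable {V : Type*} [NormedAddCommGroup V] [InnerProductSpace ℝ V]

/-- `b` enumerates a `ℤ`-basis of `Γ` that generates the cone `K`. -/
structure IsPrimitiveGenerators {m : ℕ} (Γ : Submodule ℤ V) (K : Set V) (b : Fin m → V) :
    Prop where
  linearIndependent : LinearIndependent ℤ b
  span_eq : Submodule.span ℤ (Set.range b) = Γ
  cone_eq : K = {x | ∃ c : Fin m → ℝ, (∀ j, 0 ≤ c j) ∧ x = ∑ j, c j • b j}

/-- `K` is generated by a basis of the lattice `Γ`. (If `Γ` has full rank, such a cone is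
automatically simplicial and full-dimensional.) -/
def IsUnimodularCone (Γ : Submodule ℤ V) (K : Set V) : Prop :=
  ∃ (m : ℕ) (b : Fin m → V), IsPrimitiveGenerators Γ K b

end Lattice

section GeneratingFunctions

/-- Meromorphic functions on a complex vector space of arbitrary dimension: locally a quotient of
holomorphic functions whose denominator does not vanish identically. The value of `f` at zeros of
the denominator is irrelevant. -/
def IsMeromorphic {E : Type*} [NormedAddCommGroup E] [NormedSpace ℂ E] (f : E → ℂ) : Prop :=
  ∀ z : E, ∃ g h : E → ℂ, AnalyticAt ℂ g z ∧ AnalyticAt ℂ h z ∧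
    (¬ ∀ᶠ w in nhds z, h w = 0) ∧ ∀ᶠ w in nhds z, h w ≠ 0 → f w = g w / h w

variable {V : Type*} [NormedAddCommGroup V] [InnerProductSpace ℝ V]

/-- `f` is the generating function of `S` with respect to `Γ`: a meromorphic function on the
complexified dual of `V` that on some nonempty open set is the sum of the (there convergent) series
`∑_{x ∈ S ∩ Γ} exp (-⟨x, φ⟩)`. The complexified dual `V* ⊗ ℂ` of the finite-dimensional space `V`
is realized as the complex vector space of real-linear maps `V → ℂ`, with `⟨x, φ⟩ = φ x`. -/
def IsGeneratingFunction (Γ : Submodule ℤ V) (S : Set V) (f : (V →L[ℝ] ℂ) → ℂ) : Prop :=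
  IsMeromorphic f ∧ ∃ B : Set (V →L[ℝ] ℂ), IsOpen B ∧ B.Nonempty ∧
    ∀ φ ∈ B, HasSum (fun x : ↥(S ∩ (Γ : Set V)) => Complex.exp (-φ (x : V))) (f φ)

end GeneratingFunctions

end

end SymCone

/-!
The translates of `F` tile `V`, and the facets of `F` become half-open if the point `x` is assigned
to the translate `σ F` that contains `x + ε p` for small `ε > 0`, where `p` is an interior point of
`F`. A facet `σ (F ∩ H_j)` is then removed from `σ F` exactly if `p` and `σ F` lie on different
sides of `σ H_j`, that is, if `s_j` shortens `σ` from the right. Hence `C` is the disjoint union of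
the half-open unimodular cones generated by `σ b_1, …, σ b_n` with the facets opposite to `σ b_j`
removed for the right descents `j` of `σ`, and each of them contributes a product of geometric
series.

That exactly one facet of `C ∩ F` is not a facet of `F` comes from invariant vectors: averaging
over `W` gives an invariant `v` with `ψ v > 0`, and such a `v` lies on a ray spanned by a primitive
generator `b_n`, as `ψ` is injective on invariant vectors. Since `F` contains the line through `v`
and `x + c v` lies in `C` for all large `c`, the facet opposite to `b_n` is the only one that is cut
out by `C`.
-/

namespace SymCone

open Filter Topology
open scoped RealInnerProductSpace

section Isometries

variable {V : Type*} [NormedAddCommGroup V] [InnerProductSpace ℝ V]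

theorem inv_apply_self (σ : V ≃ₗᵢ[ℝ] V) (x : V) : σ⁻¹ (σ x) = x := σ.symm_apply_apply x

theorem apply_inv_self (σ : V ≃ₗᵢ[ℝ] V) (x : V) : σ (σ⁻¹ x) = x := σ.apply_symm_apply x

theorem inner_inv_right (σ : V ≃ₗᵢ[ℝ] V) (x y : V) : ⟪x, σ⁻¹ y⟫ = ⟪σ x, y⟫ := by
  rw [← σ.inner_map_map, apply_inv_self]

theorem inner_apply_self_lt {σ : V ≃ₗᵢ[ℝ] V} {x : V} (h : σ x ≠ x) : ⟪σ x, x⟫ < ⟪x, x⟫ := by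
  have hpos : 0 < ‖σ x - x‖ ^ 2 := by
    have := norm_pos_iff.mpr (sub_ne_zero.mpr h)
    positivity
  rw [norm_sub_sq_real, σ.norm_map] at hpos
  rw [real_inner_self_eq_norm_sq]
  linarith

theorem reflection_orthogonal_singleton_apply (v x : V) :
    (ℝ ∙ v)ᗮ.reflection x = x - (2 * (⟪v, x⟫ / ‖v‖ ^ 2)) • v := by
  rw [Submodule.reflection_orthogonal_apply, Submodule.reflection_singleton_apply, neg_sub,
    ← Nat.cast_smul_eq_nsmul ℝ, smul_smul]
  simp

theorem inner_sub_inner_reflection (v x y : V) :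
    ⟪x, y⟫ - ⟪(ℝ ∙ v)ᗮ.reflection x, y⟫ = 2 / ‖v‖ ^ 2 * (⟪v, x⟫ * ⟪v, y⟫) := by
  rw [reflection_orthogonal_singleton_apply, inner_sub_left, real_inner_smul_left]
  ring

theorem reflection_orthogonal_singleton_map (σ : V ≃ₗᵢ[ℝ] V) (v : V) :
    (ℝ ∙ σ v)ᗮ.reflection = σ * (ℝ ∙ v)ᗮ.reflection * σ⁻¹ := by
  ext x
  change _ = σ ((ℝ ∙ v)ᗮ.reflection (σ⁻¹ x))
  rw [reflection_orthogonal_singleton_apply, reflection_orthogonal_singleton_apply, map_sub,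
    map_smul, apply_inv_self, inner_inv_right, σ.norm_map]

theorem eq_reflection_of_forall_apply_eq {H : Submodule ℝ V} [H.HasOrthogonalProjection]
    (hH : IsCoatom H) {σ : V ≃ₗᵢ[ℝ] V} (hσ : σ ≠ 1) (h : ∀ y ∈ H, σ y = y) :
    σ = H.reflection := by
  obtain ⟨x, hx⟩ : ∃ x, σ x ≠ x := by
    by_contra! hfix
    exact hσ (LinearIsometryEquiv.ext hfix)
  have horth : H ≤ (ℝ ∙ (x - σ x))ᗮ := fun y hy => by
    rw [Submodule.mem_orthogonal_singleton_iff_inner_right, inner_sub_left, sub_eq_zero]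
    nth_rewrite 2 [← h y hy]
    exact (σ.inner_map_map x y).symm
  have htop : (ℝ ∙ (x - σ x))ᗮ ≠ ⊤ := by
    rw [Ne, Submodule.orthogonal_eq_top_iff, Submodule.span_singleton_eq_bot, sub_eq_zero]
    exact hx.symm
  obtain rfl : (ℝ ∙ (x - σ x))ᗮ = H := (hH.le_iff_eq htop).mp horth
  have hspan : (ℝ ∙ (x - σ x))ᗮ ⊔ (ℝ ∙ x) = ⊤ := hH.2 _ <| left_lt_sup.mpr fun hle =>
    hx (h x (hle (Submodule.mem_span_singleton_self x)))
  ext y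
  obtain ⟨k, hk, z, hz, rfl⟩ := Submodule.mem_sup.mp (hspan ▸ Submodule.mem_top : y ∈ _)
  obtain ⟨a, rfl⟩ := Submodule.mem_span_singleton.mp hz
  rw [map_add, map_add, map_smul, map_smul, h k hk,
    Submodule.reflection_mem_subspace_eq_self hk, Submodule.reflection_sub (σ.norm_map x).symm]

end Isometries

section FundamentalDomain

variable {V : Type*} [NormedAddCommGroup V] [InnerProductSpace ℝ V]
  {W : Subgroup (V ≃ₗᵢ[ℝ] V)} {F : Set V}

/-- The open Dirichlet domain of `W` centred at `p`: the points that are strictly closer to `p`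
than any other point of their orbit. As `W` acts by isometries, comparing distances to `p` amounts
to comparing inner products with `p`. -/
def dirichletDomain (W : Subgroup (V ≃ₗᵢ[ℝ] V)) (p : V) : Set V :=
  {x | ∀ σ ∈ W, σ ≠ 1 → ⟪σ x, p⟫ < ⟪x, p⟫}

theorem convex_dirichletDomain (W : Subgroup (V ≃ₗᵢ[ℝ] V)) (p : V) :
    Convex ℝ (dirichletDomain W p) := by
  intro x hx y hy a b ha hb hab σ hσ hσ1
  have hxσ := hx σ hσ hσ1
  have hyσ := hy σ hσ hσ1
  simp only [map_add, map_smul, inner_add_left, real_inner_smul_left]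
  rcases ha.eq_or_lt with rfl | ha
  · rw [zero_add] at hab
    simpa [hab] using hyσ
  · exact add_lt_add_of_lt_of_le (mul_lt_mul_of_pos_left hxσ ha)
      (mul_le_mul_of_nonneg_left hyσ.le hb)

theorem isOpen_dirichletDomain (W : Subgroup (V ≃ₗᵢ[ℝ] V)) [Finite W] (p : V) :
    IsOpen (dirichletDomain W p) := by
  have hinter : dirichletDomain W p =
      ⋂ σ : {σ : W // (σ : V ≃ₗᵢ[ℝ] V) ≠ 1}, {x | ⟪((σ : W) : V ≃ₗᵢ[ℝ] V) x, p⟫ < ⟪x, p⟫} := by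
    ext x
    simp [dirichletDomain]
  rw [hinter]
  exact isOpen_iInter_of_finite fun σ => isOpen_lt
    (((σ : W) : V ≃ₗᵢ[ℝ] V).continuous.inner continuous_const)
    (continuous_id.inner continuous_const)

theorem tendsto_add_smul {E : Type*} [AddCommGroup E] [Module ℝ E] [TopologicalSpace E]
    [ContinuousAdd E] [ContinuousSMul ℝ E] (x y : E) :
    Tendsto (fun ε : ℝ => x + ε • y) (𝓝[>] 0) (𝓝 x) := by
  have : Continuous fun ε : ℝ => x + ε • y := by fun_prop
  simpa using (this.tendsto 0).mono_left nhdsWithin_le_nhds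

namespace IsFundamentalDomain

theorem isClosed (hF : IsFundamentalDomain W F) : IsClosed F := by
  obtain ⟨⟨U, -, rfl⟩, -⟩ := hF
  exact isClosed_closure

theorem exists_apply_mem (hF : IsFundamentalDomain W F) (x : V) : ∃ σ ∈ W, σ x ∈ F := by
  obtain ⟨y, ⟨hy, σ, hσ, rfl⟩, -⟩ := hF.2 x
  exact ⟨σ, hσ, hy⟩

theorem apply_eq_self (hF : IsFundamentalDomain W F) {x : V} (hx : x ∈ F) {σ : V ≃ₗᵢ[ℝ] V}
    (hσ : σ ∈ W) (hσx : σ x ∈ F) : σ x = x :=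
  (hF.2 x).unique ⟨hσx, σ, hσ, rfl⟩ ⟨hx, 1, W.one_mem, rfl⟩

theorem mem_of_forall_apply_eq (hF : IsFundamentalDomain W F) {x : V}
    (hx : ∀ σ ∈ W, σ x = x) : x ∈ F := by
  obtain ⟨σ, hσ, hσx⟩ := hF.exists_apply_mem x
  rwa [hx σ hσ] at hσx

theorem subset_closure_interior (hF : IsFundamentalDomain W F) : F ⊆ closure (interior F) := by
  obtain ⟨⟨U, hU, rfl⟩, -⟩ := hF
  exact closure_mono (interior_maximal subset_closure hU)

theorem interior_nonempty (hF : IsFundamentalDomain W F) : (interior F).Nonempty := by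
  obtain ⟨σ, -, h⟩ := hF.exists_apply_mem 0
  exact closure_nonempty_iff.mp ⟨_, hF.subset_closure_interior h⟩

theorem eq_one_of_apply_eq (hF : IsFundamentalDomain W F) {p : V} (hp : p ∈ interior F)
    {σ : V ≃ₗᵢ[ℝ] V} (hσ : σ ∈ W) (hσp : σ p = p) : σ = 1 := by
  have hmem : ∀ᶠ q in 𝓝 p, q ∈ F := mem_interior_iff_mem_nhds.mp hp
  have hmem_apply : ∀ᶠ q in 𝓝 p, σ q ∈ F := by
    have hcont := σ.continuous.tendsto p
    rw [hσp] at hcont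
    exact hcont.eventually hmem
  have hfix : ∀ᶠ q in 𝓝 p, σ q = q := by
    filter_upwards [hmem, hmem_apply] with q hq hσq using hF.apply_eq_self hq hσ hσq
  ext x
  obtain ⟨ε, hε, hε0⟩ :=
    (((tendsto_add_smul p x).eventually hfix).and self_mem_nhdsWithin).exists
  rw [map_add, map_smul, hσp, add_right_inj] at hε
  exact smul_right_injective V (ne_of_gt hε0) hε

theorem mem_dirichletDomain (hF : IsFundamentalDomain W F) {p : V} (hp : p ∈ interior F) :
    p ∈ dirichletDomain W p := fun _ hσ hσ1 =>
  inner_apply_self_lt fun h => hσ1 (hF.eq_one_of_apply_eq hp hσ h)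

variable [Finite W]

-- `F` and the union of its translates by `σ ≠ 1` are closed and cover `V`. They meet only in
-- points with nontrivial stabilizer, so the connected Dirichlet domain lies in one of them.
theorem dirichletDomain_subset (hF : IsFundamentalDomain W F) {p : V} (hp : p ∈ interior F) :
    dirichletDomain W p ⊆ F := by
  set T : Set V := ⋃ σ : {σ : W // σ ≠ 1}, ((σ : W) : V ≃ₗᵢ[ℝ] V) ⁻¹' F
  have hTclosed : IsClosed T := isClosed_iUnion_of_finite fun σ =>
    hF.isClosed.preimage ((σ : W) : V ≃ₗᵢ[ℝ] V).continuous
  have hcover : ∀ x, x ∈ F ∨ x ∈ T := by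
    intro x
    obtain ⟨σ, hσ, hσx⟩ := hF.exists_apply_mem x
    by_cases hσ1 : σ = 1
    · exact Or.inl (by simpa [hσ1] using hσx)
    · exact Or.inr (Set.mem_iUnion.mpr ⟨⟨⟨σ, hσ⟩, fun h => hσ1 (congrArg Subtype.val h)⟩, hσx⟩)
  by_contra hsub
  obtain ⟨y, hyD, hyF⟩ := Set.not_subset.mp hsub
  obtain ⟨z, hzD, hzF, hzT⟩ := isPreconnected_closed_iff.mp
    (convex_dirichletDomain W p).isPreconnected F T hF.isClosed hTclosed (fun x _ => hcover x)
    ⟨p, hF.mem_dirichletDomain hp, interior_subset hp⟩ ⟨y, hyD, (hcover y).resolve_left hyF⟩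
  obtain ⟨⟨σ, hσ1⟩, hσz⟩ := Set.mem_iUnion.mp hzT
  have hlt := hzD σ σ.2 fun h => hσ1 (Subtype.ext h)
  rw [hF.apply_eq_self hzF σ.2 hσz] at hlt
  exact lt_irrefl _ hlt

theorem mem_of_forall_inner_apply_le (hF : IsFundamentalDomain W F) {p x : V}
    (hp : p ∈ interior F) (hx : ∀ σ ∈ W, ⟪σ x, p⟫ ≤ ⟪x, p⟫) : x ∈ F := by
  refine hF.isClosed.mem_of_tendsto (tendsto_add_smul x p) ?_
  filter_upwards [self_mem_nhdsWithin] with ε hε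
  refine hF.dirichletDomain_subset hp fun σ hσ hσ1 => ?_
  rw [map_add, map_smul, inner_add_left, inner_add_left, real_inner_smul_left,
    real_inner_smul_left]
  exact add_lt_add_of_le_of_lt (hx σ hσ)
    (mul_lt_mul_of_pos_left (hF.mem_dirichletDomain hp σ hσ hσ1) hε)

theorem inner_apply_le_of_mem_interior (hF : IsFundamentalDomain W F) {p x : V}
    (hp : p ∈ interior F) (hx : x ∈ F) {σ : V ≃ₗᵢ[ℝ] V} (hσ : σ ∈ W) :
    ⟪σ x, p⟫ ≤ ⟪x, p⟫ := by
  obtain ⟨m, hm⟩ := Finite.exists_max fun τ : W => ⟪(τ : V ≃ₗᵢ[ℝ] V) x, p⟫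
  have hmx : (m : V ≃ₗᵢ[ℝ] V) x ∈ F :=
    hF.mem_of_forall_inner_apply_le hp fun τ hτ => hm ⟨τ * m, W.mul_mem hτ m.2⟩
  rw [← hF.apply_eq_self hx m.2 hmx]
  exact hm ⟨σ * m, W.mul_mem hσ m.2⟩

theorem mem_iff_forall_inner_apply_le (hF : IsFundamentalDomain W F) {p x : V}
    (hp : p ∈ interior F) : x ∈ F ↔ ∀ σ ∈ W, ⟪σ x, p⟫ ≤ ⟪x, p⟫ :=
  ⟨fun hx _ hσ => hF.inner_apply_le_of_mem_interior hp hx hσ, hF.mem_of_forall_inner_apply_le hp⟩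

theorem inner_apply_lt_of_apply_ne (hF : IsFundamentalDomain W F) {p x : V}
    (hp : p ∈ interior F) (hx : x ∈ F) {σ : V ≃ₗᵢ[ℝ] V} (hσ : σ ∈ W) (hσx : σ x ≠ x) :
    ⟪σ x, p⟫ < ⟪x, p⟫ := by
  refine (hF.inner_apply_le_of_mem_interior hp hx hσ).lt_of_ne fun heq => hσx ?_
  refine hF.apply_eq_self hx hσ (hF.mem_of_forall_inner_apply_le hp fun τ hτ => ?_)
  rw [heq]
  exact hF.inner_apply_le_of_mem_interior hp hx (W.mul_mem hτ hσ)

theorem inner_apply_le (hF : IsFundamentalDomain W F) {x y : V} (hx : x ∈ F) (hy : y ∈ F)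
    {σ : V ≃ₗᵢ[ℝ] V} (hσ : σ ∈ W) : ⟪σ x, y⟫ ≤ ⟪x, y⟫ := by
  have hclosed : IsClosed {y | ⟪σ x, y⟫ ≤ ⟪x, y⟫} :=
    isClosed_le (continuous_const.inner continuous_id) (continuous_const.inner continuous_id)
  exact hclosed.closure_subset_iff.mpr
    (fun p hp => hF.inner_apply_le_of_mem_interior hp hx hσ) (hF.subset_closure_interior hy)

theorem inner_mul_inner_nonneg (hF : IsFundamentalDomain W F) {v : V}
    (hv : (ℝ ∙ v)ᗮ.reflection ∈ W) {x y : V} (hx : x ∈ F) (hy : y ∈ F) :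
    0 ≤ ⟪v, x⟫ * ⟪v, y⟫ := by
  rcases eq_or_ne v 0 with rfl | hv0
  · simp
  have hdiff := inner_sub_inner_reflection v x y
  have hle := hF.inner_apply_le hx hy hv
  refine nonneg_of_mul_nonneg_right (a := 2 / ‖v‖ ^ 2) (by linarith) ?_
  have := norm_pos_iff.mpr hv0
  positivity

theorem add_mem (hF : IsFundamentalDomain W F) {x y : V} (hx : x ∈ F) (hy : y ∈ F) :
    x + y ∈ F := by
  obtain ⟨p, hp⟩ := hF.interior_nonempty
  rw [hF.mem_iff_forall_inner_apply_le hp] at hx hy ⊢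
  intro σ hσ
  rw [map_add, inner_add_left, inner_add_left]
  exact add_le_add (hx σ hσ) (hy σ hσ)

theorem apply_eq_of_neg_mem (hF : IsFundamentalDomain W F) {x : V} (hx : x ∈ F) (hx' : -x ∈ F)
    {σ : V ≃ₗᵢ[ℝ] V} (hσ : σ ∈ W) : σ x = x := by
  by_contra hσx
  have hle := hF.inner_apply_le hx hx' hσ
  have hlt := inner_apply_self_lt hσx
  rw [inner_neg_right, inner_neg_right] at hle
  linarith

end IsFundamentalDomain

end FundamentalDomain

section FacetHyperplanes

variable {V : Type*} [NormedAddCommGroup V] [InnerProductSpace ℝ V]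
  {W : Subgroup (V ≃ₗᵢ[ℝ] V)} {F : Set V}

theorem pos_of_mem_interior {E : Type*} [AddCommGroup E] [Module ℝ E] [TopologicalSpace E]
    [IsTopologicalAddGroup E] [ContinuousSMul ℝ E] {S : Set E} {α : Module.Dual ℝ E}
    (hα : α ≠ 0) (hS : ∀ x ∈ S, 0 ≤ α x) {x : E} (hx : x ∈ interior S) : 0 < α x := by
  have hopen : IsOpenMap α := α.isOpenMap_of_finiteDimensional (α.surjective hα)
  have himage := hopen.image_interior_subset S ⟨x, hx, rfl⟩
  rw [← Set.mem_Ioi, ← interior_Ici]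
  exact interior_mono (Set.image_subset_iff.mpr hS) himage

theorem isCoatom_ker {K E : Type*} [Field K] [AddCommGroup E] [Module K E]
    {α : Module.Dual K E} (hα : α ≠ 0) : IsCoatom (LinearMap.ker α) :=
  LinearMap.isCoatom_ker_of_surjective (α.surjective hα)

variable [Finite W]

-- If every `σ ≠ 1` in `W` moved a point of `F ∩ H`, then the sum of these points would lie in
-- `H` and in the interior of `F`.
theorem IsFacetHyperplane.exists_forall_apply_eq (hF : IsFundamentalDomain W F)
    {H : Submodule ℝ V} (hH : IsFacetHyperplane F H) :
    ∃ σ ∈ W, σ ≠ 1 ∧ ∀ x ∈ F ∩ (H : Set V), σ x = x := by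
  obtain ⟨⟨α, hα, rfl, hαF⟩, -⟩ := hH
  obtain ⟨p, hp⟩ := hF.interior_nonempty
  by_contra! hmove
  cases nonempty_fintype {σ : W // (σ : V ≃ₗᵢ[ℝ] V) ≠ 1}
  choose x hx hσx using fun σ : {σ : W // (σ : V ≃ₗᵢ[ℝ] V) ≠ 1} => hmove σ.1 σ.1.2 σ.2
  have hsum : ∑ σ, x σ ∈ dirichletDomain W p := by
    intro τ hτ hτ1
    rw [map_sum, sum_inner, sum_inner]
    exact Finset.sum_lt_sum
      (fun σ _ => hF.inner_apply_le_of_mem_interior hp (hx σ).1 hτ)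
      ⟨⟨⟨τ, hτ⟩, hτ1⟩, Finset.mem_univ _,
        hF.inner_apply_lt_of_apply_ne hp (hx _).1 hτ (hσx ⟨⟨τ, hτ⟩, hτ1⟩)⟩
  have hpos := pos_of_mem_interior hα hαF
    (interior_maximal (hF.dirichletDomain_subset hp) (isOpen_dirichletDomain W p) hsum)
  rw [map_sum, Finset.sum_eq_zero fun σ _ => (hx σ).2] at hpos
  exact lt_irrefl _ hpos

theorem IsFacetHyperplane.reflection_mem [FiniteDimensional ℝ V]
    (hF : IsFundamentalDomain W F)
    {H : Submodule ℝ V} (hH : IsFacetHyperplane F H) : H.reflection ∈ W := by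
  obtain ⟨σ, hσ, hσ1, hfix⟩ := hH.exists_forall_apply_eq hF
  obtain ⟨⟨α, hα, rfl, -⟩, hspan⟩ := hH
  rwa [← eq_reflection_of_forall_apply_eq (isCoatom_ker hα) hσ1]
  intro y hy
  rw [← hspan] at hy
  induction hy using Submodule.span_induction with
  | mem x hx => exact hfix x hx
  | zero => exact map_zero σ
  | add x y _ _ hx hy => rw [map_add, hx, hy]
  | smul a x _ hx => rw [map_smul, hx]

end FacetHyperplanes

section Descents

variable {G : Type*} [Group G] {r : ℕ} {s : Fin r → G}

theorem wordLength_prod_le (s : Fin r → G) (l : List (Fin r)) :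
    wordLength s (l.map s).prod ≤ l.length :=
  Nat.sInf_le ⟨l, rfl, rfl⟩

theorem exists_prod_eq_of_mem_closure {g : G} (hg : g ∈ Submonoid.closure (Set.range s)) :
    ∃ l : List (Fin r), (l.map s).prod = g ∧ l.length = wordLength s g := by
  obtain ⟨l', hl', rfl⟩ := Submonoid.exists_list_of_mem_closure hg
  obtain ⟨l, rfl⟩ := (Set.range_list_map s).ge hl'
  obtain ⟨k, hlength, hprod⟩ :=
    Nat.sInf_mem (⟨l.length, l, rfl, rfl⟩ : {n | ∃ k : List (Fin r), k.length = n ∧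
      (k.map s).prod = (l.map s).prod}.Nonempty)
  exact ⟨k, hprod, hlength⟩

/-- The conditions on a family of subsets `P j` of the monoid generated by involutions `s j` under
which `P j` consists of the elements that `s j` does not shorten from the right
(N. Bourbaki, *Lie groups and Lie algebras*, Chapter IV, §1.7). -/
structure IsAscentFamily (s : Fin r → G) (P : Fin r → Set G) : Prop where
  mul_self : ∀ j, s j * s j = 1
  one_mem : ∀ j, 1 ∈ P j
  mul_notMem : ∀ j, ∀ g ∈ Submonoid.closure (Set.range s), g ∈ P j → g * s j ∉ P j
  mul_eq_mul : ∀ i j, ∀ g ∈ Submonoid.closure (Set.range s),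
    g ∈ P j → s i * g ∉ P j → s i * g = g * s j

namespace IsAscentFamily

variable {P : Fin r → Set G} {j : Fin r} {g : G}

theorem prod_mem_closure (l : List (Fin r)) :
    (l.map s).prod ∈ Submonoid.closure (Set.range s) :=
  Submonoid.list_prod_mem _ fun _ hx => by
    obtain ⟨i, -, rfl⟩ := List.mem_map.mp hx
    exact Submonoid.subset_closure ⟨i, rfl⟩

theorem exists_prod_eq_mul (hP : IsAscentFamily s P) :
    ∀ l : List (Fin r), (l.map s).prod ∉ P j →
      ∃ l' : List (Fin r), l'.length + 1 = l.length ∧ (l'.map s).prod = (l.map s).prod * s j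
  | [], h => absurd (hP.one_mem j) h
  | i :: l, h => by
    rw [List.map_cons, List.prod_cons] at h ⊢
    by_cases hl : (l.map s).prod ∈ P j
    · refine ⟨l, rfl, ?_⟩
      rw [hP.mul_eq_mul i j _ (prod_mem_closure l) hl h, mul_assoc, hP.mul_self, mul_one]
    · obtain ⟨l', hlength, hprod⟩ := hP.exists_prod_eq_mul l hl
      exact ⟨i :: l', by simp [hlength], by simp [hprod, mul_assoc]⟩

theorem wordLength_mul_lt (hP : IsAscentFamily s P) (hg : g ∈ Submonoid.closure (Set.range s))
    (hgj : g ∉ P j) : wordLength s (g * s j) < wordLength s g := by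
  obtain ⟨l, rfl, hlength⟩ := exists_prod_eq_of_mem_closure hg
  obtain ⟨l', hl', hprod⟩ := hP.exists_prod_eq_mul l hgj
  have hle := wordLength_prod_le s l'
  rw [hprod] at hle
  lia

theorem mem_rightDescents_iff (hP : IsAscentFamily s P)
    (hg : g ∈ Submonoid.closure (Set.range s)) : j ∈ rightDescents s g ↔ g ∉ P j := by
  rw [rightDescents, Finset.mem_filter_univ]
  refine ⟨fun hlt hgj => ?_, hP.wordLength_mul_lt hg⟩
  have hgt := hP.wordLength_mul_lt
    (mul_mem hg (Submonoid.subset_closure ⟨j, rfl⟩)) (hP.mul_notMem j g hg hgj)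
  rw [mul_assoc, hP.mul_self, mul_one] at hgt
  exact lt_asymm hlt hgt

end IsAscentFamily

end Descents

section SimpleSystems

variable {V : Type*} [NormedAddCommGroup V] [InnerProductSpace ℝ V]
  {W : Subgroup (V ≃ₗᵢ[ℝ] V)} {F : Set V} {r : ℕ} {a : Fin r → V} {p : V}

theorem IsFundamentalDomain.inner_ne_zero (hF : IsFundamentalDomain W F) (hp : p ∈ interior F)
    {v : V} (hv0 : v ≠ 0) (hv : (ℝ ∙ v)ᗮ.reflection ∈ W) : ⟪v, p⟫ ≠ 0 := by
  intro h
  have hone := hF.eq_one_of_apply_eq hp hv (Submodule.reflection_mem_subspace_eq_self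
    (Submodule.mem_orthogonal_singleton_iff_inner_right.mpr h))
  have hneg := Submodule.reflection_orthogonalComplement_singleton_eq_neg (𝕜 := ℝ) v
  rw [hone, LinearIsometryEquiv.coe_one, id, eq_neg_iff_add_eq_zero, ← two_smul ℝ] at hneg
  exact hv0 ((smul_eq_zero_iff_right two_ne_zero).mp hneg)

/-- The vectors `a j` are simple roots of the chamber `F`: they are normal to the walls of `F`,
point to the inner side, and the reflections at these walls belong to `W`. That `a j` is not
redundant is expressed by saying that the corresponding face of `F` spans the wall. -/
structure IsSimpleSystem (W : Subgroup (V ≃ₗᵢ[ℝ] V)) (F : Set V) (a : Fin r → V) : Prop where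
  ne_zero : ∀ j, a j ≠ 0
  reflection_mem : ∀ j, (ℝ ∙ a j)ᗮ.reflection ∈ W
  mem_iff : ∀ x, x ∈ F ↔ ∀ j, 0 ≤ ⟪a j, x⟫
  span_eq : ∀ j, Submodule.span ℝ (F ∩ ((ℝ ∙ a j)ᗮ : Submodule ℝ V)) = (ℝ ∙ a j)ᗮ

namespace IsSimpleSystem

variable {σ : V ≃ₗᵢ[ℝ] V}

theorem reflection_apply_mem (ha : IsSimpleSystem W F a) (hσ : σ ∈ W) (j : Fin r) :
    (ℝ ∙ σ (a j))ᗮ.reflection ∈ W := by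
  rw [reflection_orthogonal_singleton_map]
  exact W.mul_mem (W.mul_mem hσ (ha.reflection_mem j)) (W.inv_mem hσ)

theorem closure_le (ha : IsSimpleSystem W F a) :
    Submonoid.closure (Set.range fun j => (ℝ ∙ a j)ᗮ.reflection) ≤ W.toSubmonoid :=
  Submonoid.closure_le.mpr <| Set.range_subset_iff.mpr ha.reflection_mem

variable (hF : IsFundamentalDomain W F) (hp : p ∈ interior F)

include hF hp

theorem inner_apply_ne_zero (ha : IsSimpleSystem W F a) (hσ : σ ∈ W) (j : Fin r) :
    ⟪σ (a j), p⟫ ≠ 0 :=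
  hF.inner_ne_zero hp (by simpa using ha.ne_zero j) (ha.reflection_apply_mem hσ j)

theorem inner_pos (ha : IsSimpleSystem W F a) (j : Fin r) : 0 < ⟪a j, p⟫ :=
  ((ha.mem_iff p).mp (interior_subset hp) j).lt_of_ne'
    (ha.inner_apply_ne_zero hF hp W.one_mem j)

variable [Finite W]

theorem orthogonal_eq_of_inner_pos_of_inner_neg (ha : IsSimpleSystem W F a) {v : V}
    (hv : (ℝ ∙ v)ᗮ.reflection ∈ W) {i : Fin r} (hpos : 0 < ⟪v, p⟫)
    (hneg : ⟪(ℝ ∙ a i)ᗮ.reflection v, p⟫ < 0) : (ℝ ∙ v)ᗮ = (ℝ ∙ a i)ᗮ := by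
  have hpF := interior_subset hp
  have hface : F ∩ ((ℝ ∙ a i)ᗮ : Submodule ℝ V) ⊆ (ℝ ∙ v)ᗮ := by
    rintro y ⟨hyF, hy⟩
    have hreflect : (ℝ ∙ (ℝ ∙ a i)ᗮ.reflection v)ᗮ.reflection ∈ W := by
      rw [reflection_orthogonal_singleton_map]
      exact W.mul_mem (W.mul_mem (ha.reflection_mem i) hv) (W.inv_mem (ha.reflection_mem i))
    have hnonneg := nonneg_of_mul_nonneg_left (hF.inner_mul_inner_nonneg hv hyF hpF) hpos
    have hnonpos := nonpos_of_mul_nonneg_left (hF.inner_mul_inner_nonneg hreflect hyF hpF) hneg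
    rw [← Submodule.reflection_mem_subspace_eq_self hy, LinearIsometryEquiv.inner_map_map]
      at hnonpos
    exact Submodule.mem_orthogonal_singleton_iff_inner_right.mpr (hnonpos.antisymm hnonneg)
  have hle : (ℝ ∙ a i)ᗮ ≤ (ℝ ∙ v)ᗮ := by
    rw [← ha.span_eq i]
    exact Submodule.span_le.mpr hface
  have hmem : v ∈ (ℝ ∙ a i)ᗮᗮ :=
    Submodule.orthogonal_le hle (Submodule.le_orthogonal_orthogonal _
      (Submodule.mem_span_singleton_self v))
  rw [Submodule.orthogonal_orthogonal] at hmem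
  obtain ⟨c, rfl⟩ := Submodule.mem_span_singleton.mp hmem
  have hc : c ≠ 0 := by
    rintro rfl
    simp at hpos
  rw [Submodule.span_singleton_smul_eq hc.isUnit]

theorem isAscentFamily (ha : IsSimpleSystem W F a) :
    IsAscentFamily (fun j => (ℝ ∙ a j)ᗮ.reflection) fun j => {σ | 0 < ⟪σ (a j), p⟫} where
  mul_self j := Submodule.reflection_mul_reflection _
  one_mem j := ha.inner_pos hF hp j
  mul_notMem j σ _ hσj hmul := by
    change 0 < ⟪σ ((ℝ ∙ a j)ᗮ.reflection (a j)), p⟫ at hmul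
    rw [Submodule.reflection_orthogonalComplement_singleton_eq_neg, map_neg, inner_neg_left] at hmul
    exact lt_asymm (neg_pos.mp hmul) hσj
  mul_eq_mul i j σ hσ hσj hmul := by
    have hσW := ha.closure_le hσ
    have hne := ha.inner_apply_ne_zero hF hp (W.mul_mem (ha.reflection_mem i) hσW) j
    have horth := ha.orthogonal_eq_of_inner_pos_of_inner_neg hF hp
      (ha.reflection_apply_mem hσW j) hσj ((not_lt.mp hmul).lt_of_ne hne)
    calc (ℝ ∙ a i)ᗮ.reflection * σ = (ℝ ∙ σ (a j))ᗮ.reflection * σ := by simp only [horth]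
      _ = σ * (ℝ ∙ a j)ᗮ.reflection := by
        rw [reflection_orthogonal_singleton_map, inv_mul_cancel_right]

theorem mem_closure (ha : IsSimpleSystem W F a) (hσ : σ ∈ W) :
    σ ∈ Submonoid.closure (Set.range fun j => (ℝ ∙ a j)ᗮ.reflection) := by
  set M := Submonoid.closure (Set.range fun j => (ℝ ∙ a j)ᗮ.reflection)
  have : Nonempty {τ : W // (τ : V ≃ₗᵢ[ℝ] V) ∈ M} := ⟨⟨1, M.one_mem⟩⟩
  obtain ⟨⟨m, hmM⟩, hm⟩ := Finite.exists_max fun τ : {τ : W // (τ : V ≃ₗᵢ[ℝ] V) ∈ M} =>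
    ⟪((τ : W) : V ≃ₗᵢ[ℝ] V) (σ⁻¹ p), p⟫
  have hmF : (m : V ≃ₗᵢ[ℝ] V) (σ⁻¹ p) ∈ F := by
    refine (ha.mem_iff _).mpr fun j => ?_
    have hmax := hm ⟨⟨_, W.mul_mem (ha.reflection_mem j) m.2⟩,
      M.mul_mem (Submonoid.subset_closure ⟨j, rfl⟩) hmM⟩
    have hdiff := inner_sub_inner_reflection (a j) ((m : V ≃ₗᵢ[ℝ] V) (σ⁻¹ p)) p
    have hnorm := norm_pos_iff.mpr (ha.ne_zero j)
    have hprod : 0 ≤ ⟪a j, (m : V ≃ₗᵢ[ℝ] V) (σ⁻¹ p)⟫ * ⟪a j, p⟫ :=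
      nonneg_of_mul_nonneg_right (hdiff ▸ sub_nonneg.mpr hmax) (by positivity)
    exact nonneg_of_mul_nonneg_left hprod (ha.inner_pos hF hp j)
  have hmσ : (m : V ≃ₗᵢ[ℝ] V) * σ⁻¹ = 1 :=
    have hmem := W.mul_mem m.2 (W.inv_mem hσ)
    hF.eq_one_of_apply_eq hp hmem (hF.apply_eq_self (interior_subset hp) hmem hmF)
  rwa [← mul_inv_eq_one.mp hmσ]

theorem mem_rightDescents_iff (ha : IsSimpleSystem W F a) (hσ : σ ∈ W) {j : Fin r} :
    j ∈ rightDescents (fun i => (ℝ ∙ a i)ᗮ.reflection) σ ↔ ⟪σ (a j), p⟫ < 0 := by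
  rw [(ha.isAscentFamily hF hp).mem_rightDescents_iff (ha.mem_closure hF hp hσ),
    Set.mem_ofPred_eq, not_lt, (ha.inner_apply_ne_zero hF hp hσ j).le_iff_lt]

theorem exists_forall_inner_ne_zero (ha : IsSimpleSystem W F a) (x : V) :
    ∃ σ : W, (σ : V ≃ₗᵢ[ℝ] V)⁻¹ x ∈ F ∧
      ∀ j ∈ rightDescents (fun i => (ℝ ∙ a i)ᗮ.reflection) (σ : V ≃ₗᵢ[ℝ] V),
        ⟪a j, (σ : V ≃ₗᵢ[ℝ] V)⁻¹ x⟫ ≠ 0 := by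
  obtain ⟨τ, hτ, hτx⟩ := hF.exists_apply_mem x
  have : Nonempty {σ : W // (σ : V ≃ₗᵢ[ℝ] V)⁻¹ x ∈ F} := ⟨⟨⟨τ, hτ⟩⁻¹, by simpa using hτx⟩⟩
  obtain ⟨⟨σ, hσx⟩, hmax⟩ := Finite.exists_max
    fun σ : {σ : W // (σ : V ≃ₗᵢ[ℝ] V)⁻¹ x ∈ F} => ⟪((σ : W) : V ≃ₗᵢ[ℝ] V)⁻¹ p, p⟫
  refine ⟨σ, hσx, fun j hj hzero => ?_⟩
  rw [ha.mem_rightDescents_iff hF hp σ.2, ← inner_inv_right] at hj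
  have hwall := Submodule.reflection_mem_subspace_eq_self
    (Submodule.mem_orthogonal_singleton_iff_inner_right.mpr hzero)
  have hle := hmax ⟨σ * ⟨_, ha.reflection_mem j⟩, by
    rw [Subgroup.coe_mul, mul_inv_rev, Submodule.reflection_inv]
    exact hwall.symm ▸ hσx⟩
  simp only [Subgroup.coe_mul, mul_inv_rev, Submodule.reflection_inv] at hle
  have hdiff := inner_sub_inner_reflection (a j) ((σ : V ≃ₗᵢ[ℝ] V)⁻¹ p) p
  have hnorm := norm_pos_iff.mpr (ha.ne_zero j)
  have hneg : 2 / ‖a j‖ ^ 2 * (⟪a j, (σ : V ≃ₗᵢ[ℝ] V)⁻¹ p⟫ * ⟪a j, p⟫) < 0 :=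
    mul_neg_of_pos_of_neg (by positivity) (mul_neg_of_neg_of_pos hj (ha.inner_pos hF hp j))
  exact (sub_nonneg.mpr hle).not_gt (hdiff ▸ hneg)

theorem eventually_add_smul_mem (ha : IsSimpleSystem W F a) (hσ : σ ∈ W) {x : V}
    (hx : σ⁻¹ x ∈ F)
    (hne : ∀ j ∈ rightDescents (fun i => (ℝ ∙ a i)ᗮ.reflection) σ, ⟪a j, σ⁻¹ x⟫ ≠ 0) :
    ∀ᶠ ε : ℝ in 𝓝[>] 0, σ⁻¹ (x + ε • p) ∈ F := by
  simp only [ha.mem_iff, eventually_all] at hx ⊢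
  intro j
  by_cases hj : j ∈ rightDescents (fun i => (ℝ ∙ a i)ᗮ.reflection) σ
  · have hpos : ∀ᶠ y in 𝓝 x, 0 < ⟪a j, σ⁻¹ y⟫ :=
      (continuous_const.inner σ⁻¹.continuous).continuousAt.eventually
        (lt_mem_nhds ((hx j).lt_of_ne' (hne j hj)))
    exact (tendsto_add_smul x p).eventually (hpos.mono fun _ => le_of_lt)
  · rw [ha.mem_rightDescents_iff hF hp hσ, not_lt, ← inner_inv_right] at hj
    filter_upwards [self_mem_nhdsWithin] with ε hε
    rw [map_add, map_smul, inner_add_right, real_inner_smul_right]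
    exact add_nonneg (hx j) (mul_nonneg (le_of_lt hε) hj)

theorem existsUnique_forall_inner_ne_zero (ha : IsSimpleSystem W F a) (x : V) :
    ∃! σ : W, (σ : V ≃ₗᵢ[ℝ] V)⁻¹ x ∈ F ∧
      ∀ j ∈ rightDescents (fun i => (ℝ ∙ a i)ᗮ.reflection) (σ : V ≃ₗᵢ[ℝ] V),
        ⟪a j, (σ : V ≃ₗᵢ[ℝ] V)⁻¹ x⟫ ≠ 0 := by
  refine existsUnique_of_exists_of_unique (ha.exists_forall_inner_ne_zero hF hp x) ?_
  rintro ⟨σ, hσ⟩ ⟨τ, hτ⟩ ⟨hσx, hσne⟩ ⟨hτx, hτne⟩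
  obtain ⟨ε, ⟨hσε, hτε⟩, hε⟩ := (((ha.eventually_add_smul_mem hF hp hσ hσx hσne).and
    (ha.eventually_add_smul_mem hF hp hτ hτx hτne)).and self_mem_nhdsWithin).exists
  have hsame : ∀ y, σ⁻¹ y ∈ F → τ⁻¹ y ∈ F → τ⁻¹ y = σ⁻¹ y := fun y hσy hτy =>
    (hF.2 y).unique ⟨hτy, _, W.inv_mem hτ, rfl⟩ ⟨hσy, _, W.inv_mem hσ, rfl⟩
  have hadd := hsame _ hσε hτε
  rw [map_add, map_add, map_smul, map_smul, hsame x hσx hτx, add_right_inj] at hadd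
  have hp_eq : τ⁻¹ p = σ⁻¹ p := smul_right_injective V (ne_of_gt hε) hadd
  have hone := hF.eq_one_of_apply_eq hp (W.mul_mem hσ (W.inv_mem hτ))
    ((congrArg σ hp_eq).trans (apply_inv_self σ p))
  exact Subtype.ext (mul_inv_eq_one.mp hone)

end IsSimpleSystem

end SimpleSystems

section SimplicialCones

variable {V : Type*} [NormedAddCommGroup V] [InnerProductSpace ℝ V] {F : Set V}
  {ι κ : Type*} {f : κ → ι}

theorem coord_apply_eq_ite {K M : Type*} [Semiring K] [AddCommMonoid M] [Module K M]
    [DecidableEq ι] (b : Module.Basis ι K M) (i j : ι) :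
    b.coord i (b j) = if j = i then 1 else 0 := by
  rw [b.coord_apply, b.repr_self, Finsupp.single_apply]

theorem coord_ne_zero {K M : Type*} [Semiring K] [Nontrivial K] [AddCommMonoid M] [Module K M]
    (b : Module.Basis ι K M) (i : ι) : b.coord i ≠ 0 := fun h => by
  classical simpa [coord_apply_eq_ite] using LinearMap.congr_fun h (b i)

theorem ker_coord_injective {K M : Type*} [Semiring K] [Nontrivial K] [AddCommMonoid M]
    [Module K M] (b : Module.Basis ι K M) :
    Function.Injective fun i => LinearMap.ker (b.coord i) := fun i j hij => by
  classical
  have hmem : b j ∉ LinearMap.ker (b.coord i) := by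
    rw [show LinearMap.ker (b.coord i) = LinearMap.ker (b.coord j) from hij, LinearMap.mem_ker,
      coord_apply_eq_ite, if_pos rfl]
    exact one_ne_zero
  rw [LinearMap.mem_ker, coord_apply_eq_ite] at hmem
  by_contra hne
  exact hmem (if_neg (Ne.symm hne))

theorem basis_mem_of_mem_iff_coord_nonneg {b : Module.Basis ι ℝ V}
    (hF : ∀ x, x ∈ F ↔ ∀ k, 0 ≤ b.coord (f k) x) (i : ι) : b i ∈ F := by
  classical
  refine (hF _).mpr fun k => ?_
  rw [coord_apply_eq_ite]
  positivity

variable [Finite ι] {b : Module.Basis ι ℝ V} (hF : ∀ x, x ∈ F ↔ ∀ k, 0 ≤ b.coord (f k) x)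

include hF

theorem isFacetHyperplane_ker_coord (k : κ) :
    IsFacetHyperplane F (LinearMap.ker (b.coord (f k))) := by
  classical
  cases nonempty_fintype ι
  refine ⟨⟨_, coord_ne_zero b _, rfl, fun x hx => (hF x).mp hx k⟩,
    le_antisymm (Submodule.span_le.mpr Set.inter_subset_right) fun x hx => ?_⟩
  rw [← b.sum_repr x]
  refine Submodule.sum_mem _ fun j _ => ?_
  rcases eq_or_ne j (f k) with rfl | hj
  · rw [← b.coord_apply, LinearMap.mem_ker.mp hx, zero_smul]
    exact Submodule.zero_mem _
  · refine Submodule.smul_mem _ _ (Submodule.subset_span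
      ⟨basis_mem_of_mem_iff_coord_nonneg hF j, ?_⟩)
    rw [SetLike.mem_coe, LinearMap.mem_ker, coord_apply_eq_ite, if_neg hj]

theorem IsFacetHyperplane.exists_eq_ker_coord {L : Submodule ℝ V} (hL : IsFacetHyperplane F L) :
    ∃ k, L = LinearMap.ker (b.coord (f k)) := by
  classical
  cases nonempty_fintype ι
  obtain ⟨⟨α, hα0, rfl, hα⟩, hspan⟩ := hL
  have hb := basis_mem_of_mem_iff_coord_nonneg hF
  have hzero : ∀ i ∉ Set.range f, α (b i) = 0 := fun i hi => by
    have hneg : -b i ∈ F := (hF _).mpr fun k => by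
      rw [map_neg, coord_apply_eq_ite, if_neg fun h => hi ⟨k, h.symm⟩, neg_zero]
    have hle := hα _ hneg
    rw [map_neg, neg_nonneg] at hle
    exact hle.antisymm (hα _ (hb i))
  obtain ⟨k, hk⟩ : ∃ k, α (b (f k)) ≠ 0 := by
    by_contra! hcon
    refine hα0 (b.ext fun i => ?_)
    by_cases hi : i ∈ Set.range f
    · obtain ⟨k, rfl⟩ := hi
      exact hcon k
    · exact hzero i hi
  have hnonneg : ∀ x ∈ F, ∀ i ∈ Finset.univ, 0 ≤ b.coord i x * α (b i) := fun x hx i _ => by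
    by_cases hi : i ∈ Set.range f
    · obtain ⟨k, rfl⟩ := hi
      exact mul_nonneg ((hF x).mp hx k) (hα _ (hb _))
    · rw [hzero i hi, mul_zero]
  have hle : LinearMap.ker α ≤ LinearMap.ker (b.coord (f k)) := by
    rw [← hspan, Submodule.span_le]
    rintro x ⟨hxF, hx⟩
    have hsum : ∑ i, b.coord i x * α (b i) = 0 := by
      rw [← LinearMap.mem_ker.mp hx]
      conv_rhs => rw [← b.sum_repr x, map_sum]
      simp only [map_smul, smul_eq_mul, b.coord_apply]
    exact (mul_eq_zero.mp ((Finset.sum_eq_zero_iff_of_nonneg (hnonneg x hxF)).mp hsum _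
      (Finset.mem_univ (f k)))).resolve_right hk
  exact ⟨k, (((isCoatom_ker hα0).le_iff_eq (isCoatom_ker (coord_ne_zero b _)).1).mp hle).symm⟩

end SimplicialCones

section PrimitiveGenerators

variable {V : Type*} [NormedAddCommGroup V] [InnerProductSpace ℝ V] {Γ : Submodule ℤ V}
  {K : Set V} {m n : ℕ} {b : Fin m → V}

namespace IsPrimitiveGenerators

theorem comp_equiv (h : IsPrimitiveGenerators Γ K b) (e : Fin n ≃ Fin m) :
    IsPrimitiveGenerators Γ K (b ∘ e) where
  linearIndependent := h.linearIndependent.comp _ e.injective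
  span_eq := by rw [Set.range_comp, e.range_eq_univ, Set.image_univ, h.span_eq]
  cone_eq := by
    rw [h.cone_eq]
    ext x
    constructor
    · rintro ⟨c, hc, rfl⟩
      exact ⟨c ∘ e, fun j => hc _, (Equiv.sum_comp e fun j => c j • b j).symm⟩
    · rintro ⟨c, hc, rfl⟩
      refine ⟨c ∘ e.symm, fun j => hc _, ?_⟩
      rw [← Equiv.sum_comp e]
      simp

theorem mem_lattice (h : IsPrimitiveGenerators Γ K b) (i : Fin m) : b i ∈ Γ :=
  h.span_eq ▸ Submodule.subset_span ⟨i, rfl⟩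

variable [FiniteDimensional ℝ V] [DiscreteTopology Γ] [IsZLattice ℝ Γ]

/-- Primitive generators as a basis of `V`; they span `V` because `Γ` has full rank. -/
noncomputable def basis (h : IsPrimitiveGenerators Γ K b) : Module.Basis (Fin m) ℝ V :=
  ((Module.Basis.span h.linearIndependent).map (LinearEquiv.ofEq _ _ h.span_eq)).ofZLatticeBasis ℝ Γ

theorem coe_basis (h : IsPrimitiveGenerators Γ K b) : ⇑h.basis = b := by
  ext i
  rw [basis, Module.Basis.ofZLatticeBasis_apply, Module.Basis.map_apply,
    LinearEquiv.coe_ofEq_apply, Module.Basis.span_apply]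

theorem basis_comp_equiv (h : IsPrimitiveGenerators Γ K b) (e : Fin n ≃ Fin m) :
    (h.comp_equiv e).basis = h.basis.reindex e.symm :=
  Module.Basis.eq_of_apply_eq fun i => by simp [coe_basis]

theorem mem_cone_iff (h : IsPrimitiveGenerators Γ K b) {x : V} :
    x ∈ K ↔ ∀ i, 0 ≤ h.basis.coord i x := by
  conv_lhs => rw [h.cone_eq, ← h.coe_basis]
  constructor
  · rintro ⟨c, hc, rfl⟩ i
    rw [Module.Basis.coord_apply, Module.Basis.repr_sum_self]
    exact hc i
  · exact fun hx => ⟨fun i => h.basis.coord i x, hx, (h.basis.sum_repr x).symm⟩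

theorem mem_lattice_iff (h : IsPrimitiveGenerators Γ K b) {x : V} :
    x ∈ Γ ↔ ∀ i, ∃ k : ℤ, h.basis.coord i x = k := by
  conv_lhs => rw [← h.span_eq, ← h.coe_basis]
  rw [Module.Basis.mem_span_iff_repr_mem]
  simp [eq_comm]

theorem mem_cone (h : IsPrimitiveGenerators Γ K b) (i : Fin m) : b i ∈ K := by
  rw [← h.coe_basis]
  exact basis_mem_of_mem_iff_coord_nonneg (f := id) (fun _ => h.mem_cone_iff) i

theorem ne_zero (h : IsPrimitiveGenerators Γ K b) (i : Fin m) : b i ≠ 0 := by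
  rw [← h.coe_basis]
  exact h.basis.ne_zero i

theorem coord_apply_eq_ite (h : IsPrimitiveGenerators Γ K b) (i j : Fin m) :
    h.basis.coord i (b j) = if j = i then 1 else 0 := by
  rw [← SymCone.coord_apply_eq_ite h.basis i j, h.coe_basis]

theorem exists_sub_mem (h : IsPrimitiveGenerators Γ K b) {x : V} (hxK : x ∈ K) (hxΓ : x ∈ Γ)
    (hx : x ≠ 0) : ∃ i, x - b i ∈ K := by
  obtain ⟨i, hi⟩ : ∃ i, h.basis.coord i x ≠ 0 := by
    by_contra! hzero
    exact hx (h.basis.ext_elem fun i => by simpa using hzero i)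
  have hone : 1 ≤ h.basis.coord i x := by
    obtain ⟨k, hk⟩ := h.mem_lattice_iff.mp hxΓ i
    have hpos := (h.mem_cone_iff.mp hxK i).lt_of_ne' hi
    rw [hk] at hpos ⊢
    exact_mod_cast hpos
  refine ⟨i, h.mem_cone_iff.mpr fun l => ?_⟩
  rw [map_sub, h.coord_apply_eq_ite, sub_nonneg]
  split_ifs with hl
  · exact hl ▸ hone
  · exact h.mem_cone_iff.mp hxK l

theorem eq_of_sub_mem (h : IsPrimitiveGenerators Γ K b) {x : V} (hxK : x ∈ K) (hxΓ : x ∈ Γ)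
    (hx : x ≠ 0) {i : Fin m} (hsub : b i - x ∈ K) : x = b i := by
  have hnonneg := h.mem_cone_iff.mp hxK
  have hle : ∀ l, h.basis.coord l x ≤ if i = l then 1 else 0 := fun l => by
    simpa only [map_sub, h.coord_apply_eq_ite, sub_nonneg] using h.mem_cone_iff.mp hsub l
  have hzero : ∀ l ≠ i, h.basis.coord l x = 0 := fun l hl =>
    (hnonneg l).antisymm' (by simpa only [if_neg (Ne.symm hl)] using hle l)
  have hsmul : x = h.basis.coord i x • b i := by
    refine h.basis.ext_elem fun l => ?_
    rw [← h.basis.coord_apply, ← h.basis.coord_apply, map_smul, h.coord_apply_eq_ite]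
    split_ifs with hl
    · rw [hl, smul_eq_mul, mul_one]
    · rw [hzero l (Ne.symm hl), smul_zero]
  obtain ⟨k, hk⟩ := h.mem_lattice_iff.mp hxΓ i
  have hk1 : k = 1 := by
    have hk_nonneg : 0 ≤ k := by exact_mod_cast hk ▸ hnonneg i
    have hk_le : k ≤ 1 := by exact_mod_cast hk ▸ (hle i).trans_eq (if_pos rfl)
    have hk_ne : k ≠ 0 := by
      rintro rfl
      rw [hk, Int.cast_zero, zero_smul] at hsmul
      exact hx hsmul
    lia
  rw [hsmul, hk, hk1, Int.cast_one, one_smul]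

-- The primitive generators are the lattice points of the cone that are indecomposable, hence they
-- do not depend on the chosen basis.
theorem mem_range {b' : Fin n → V} (h : IsPrimitiveGenerators Γ K b)
    (h' : IsPrimitiveGenerators Γ K b') (j : Fin n) : b' j ∈ Set.range b := by
  obtain ⟨i, hi⟩ := h.exists_sub_mem (h'.mem_cone j) (h'.mem_lattice j) (h'.ne_zero j)
  exact ⟨i, h'.eq_of_sub_mem (h.mem_cone i) (h.mem_lattice i) (h.ne_zero i) hi⟩

theorem eq_of_coord_ne_zero {b b' : Fin (n + 1) → V} (h : IsPrimitiveGenerators Γ K b)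
    (h' : IsPrimitiveGenerators Γ K b')
    (hne : ∀ j : Fin n, h.basis.coord j.castSucc (b' j.castSucc) ≠ 0) : b' = b := by
  have hinit : ∀ j : Fin n, b' j.castSucc = b j.castSucc := fun j => by
    obtain ⟨i, hi⟩ := h.mem_range h' j.castSucc
    have hcoord := hne j
    rw [← hi, h.coord_apply_eq_ite, ite_ne_right_iff] at hcoord
    rw [← hi, hcoord.1]
  refine funext <| Fin.lastCases ?_ hinit
  obtain ⟨i, hi⟩ := h.mem_range h' (Fin.last n)
  induction i using Fin.lastCases with
  | last => exact hi.symm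
  | cast i =>
    rw [← hinit] at hi
    exact absurd (h'.linearIndependent.injective hi) (Fin.castSucc_lt_last i).ne

end IsPrimitiveGenerators

end PrimitiveGenerators

section SymmetricCones

variable {V : Type*} [NormedAddCommGroup V] [InnerProductSpace ℝ V]
  {W : Subgroup (V ≃ₗᵢ[ℝ] V)} {ψ : Module.Dual ℝ V} {F : Set V}

/-- The symmetric cone cut out by the `W`-orbit of a single linear form. -/
def symmetricCone (W : Subgroup (V ≃ₗᵢ[ℝ] V)) (ψ : Module.Dual ℝ V) : Set V :=
  {x | ∀ σ ∈ W, 0 ≤ ψ (σ x)}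

theorem apply_mem_symmetricCone_iff {σ : V ≃ₗᵢ[ℝ] V} (hσ : σ ∈ W) {x : V} :
    σ x ∈ symmetricCone W ψ ↔ x ∈ symmetricCone W ψ :=
  ⟨fun h τ hτ => by simpa [inv_apply_self] using h (τ * σ⁻¹) (W.mul_mem hτ (W.inv_mem hσ)),
    fun h τ hτ => h (τ * σ) (W.mul_mem hτ hσ)⟩

theorem exists_add_smul_mem_symmetricCone [Finite W] {v : V} (hv : ∀ σ ∈ W, σ v = v)
    (hψv : 0 < ψ v) (x : V) : ∃ c : ℝ, x + c • v ∈ symmetricCone W ψ := by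
  obtain ⟨τ, hτ⟩ := Finite.exists_min fun σ : W => ψ ((σ : V ≃ₗᵢ[ℝ] V) x)
  refine ⟨-ψ ((τ : V ≃ₗᵢ[ℝ] V) x) / ψ v, fun σ hσ => ?_⟩
  rw [map_add, map_add, map_smul, hv σ hσ, map_smul, smul_eq_mul, div_mul_cancel₀ _ hψv.ne']
  linarith [hτ ⟨σ, hσ⟩]

section Pointed

variable (hψ : ∀ x, (∀ σ ∈ W, ψ (σ x) = 0) → x = 0)

include hψ

theorem sum_apply_pos_of_mem_symmetricCone [Fintype W] {x : V} (hx : x ∈ symmetricCone W ψ)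
    (hx0 : x ≠ 0) : 0 < ∑ σ : W, ψ ((σ : V ≃ₗᵢ[ℝ] V) x) := by
  by_contra! hle
  have hnonneg : ∀ σ ∈ Finset.univ, 0 ≤ ψ (((σ : W) : V ≃ₗᵢ[ℝ] V) x) := fun σ _ => hx σ σ.2
  have hzero := (Finset.sum_eq_zero_iff_of_nonneg hnonneg).mp
    (hle.antisymm (Finset.sum_nonneg hnonneg))
  exact hx0 (hψ x fun σ hσ => hzero ⟨σ, hσ⟩ (Finset.mem_univ _))

theorem exists_forall_apply_eq_and_pos [Finite W] {x : V} (hx : x ∈ symmetricCone W ψ)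
    (hx0 : x ≠ 0) : ∃ v, (∀ σ ∈ W, σ v = v) ∧ 0 < ψ v := by
  cases nonempty_fintype W
  refine ⟨∑ σ : W, (σ : V ≃ₗᵢ[ℝ] V) x, fun τ hτ => ?_, ?_⟩
  · rw [map_sum]
    exact Fintype.sum_equiv (Equiv.mulLeft ⟨τ, hτ⟩) _ _ fun _ => rfl
  · rw [map_sum]
    exact sum_apply_pos_of_mem_symmetricCone hψ hx hx0

theorem smul_eq_smul_of_forall_apply_eq {x y : V} (hx : ∀ σ ∈ W, σ x = x)
    (hy : ∀ σ ∈ W, σ y = y) : ψ y • x = ψ x • y := by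
  refine sub_eq_zero.mp (hψ _ fun σ hσ => ?_)
  rw [map_sub, map_smul, map_smul, hx σ hσ, hy σ hσ, map_sub, map_smul, map_smul, smul_eq_mul,
    smul_eq_mul, mul_comm, sub_self]

end Pointed

theorem exists_forall_coord_add_smul_nonneg {E ι : Type*} [AddCommGroup E] [Module ℝ E]
    [Finite ι] {b : Module.Basis ι ℝ E} {v : E} (hv : ∀ i, 0 ≤ b.coord i v)
    {x : E} (hx : ∀ i, b.coord i v = 0 → 0 ≤ b.coord i x) :
    ∃ c : ℝ, ∀ i, 0 ≤ b.coord i (x + c • v) := by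
  obtain ⟨c, hc⟩ := Set.finite_range (fun i => -b.coord i x / b.coord i v) |>.bddAbove
  refine ⟨c, fun i => ?_⟩
  rw [map_add, map_smul, smul_eq_mul]
  rcases (hv i).eq_or_lt' with h0 | hpos
  · rw [h0, mul_zero, add_zero]
    exact hx i h0
  · have hle := (div_le_iff₀ hpos).mp (hc ⟨i, rfl⟩)
    linarith

variable [Finite W] {ι : Type*} {b : Module.Basis ι ℝ V} (hF : IsFundamentalDomain W F)
  (hb : ∀ x, x ∈ symmetricCone W ψ ∩ F ↔ ∀ i, 0 ≤ b.coord i x)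

include hF hb

theorem IsFundamentalDomain.mem_iff_forall_coord_nonneg [Finite ι] {v : V}
    (hv : ∀ σ ∈ W, σ v = v) (hψv : 0 < ψ v) {x : V} :
    x ∈ F ↔ ∀ i, b.coord i v = 0 → 0 ≤ b.coord i x := by
  have hsmul : ∀ c : ℝ, c • v ∈ F := fun c =>
    hF.mem_of_forall_apply_eq fun σ hσ => by rw [map_smul, hv σ hσ]
  constructor
  · intro hx i hi
    obtain ⟨c, hc⟩ := exists_add_smul_mem_symmetricCone hv hψv x
    have hcoord := (hb _).mp ⟨hc, hF.add_mem hx (hsmul c)⟩ i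
    rwa [map_add, map_smul, hi, smul_zero, add_zero] at hcoord
  · intro hx
    have hv_mem : v ∈ symmetricCone W ψ := fun σ hσ => (hv σ hσ).symm ▸ hψv.le
    obtain ⟨c, hc⟩ := exists_forall_coord_add_smul_nonneg
      ((hb v).mp ⟨hv_mem, hF.mem_of_forall_apply_eq hv⟩) hx
    simpa using hF.add_mem ((hb _).mpr hc).2 (hsmul (-c))

-- A generator `b k` that occurs in the invariant vector `v` spans a line in `F`, so it is invariant
-- as well, hence proportional to `v`.
theorem IsFundamentalDomain.exists_mem_iff_forall_coord_nonneg [Finite ι] [Nonempty ι]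
    (hψ : ∀ x, (∀ σ ∈ W, ψ (σ x) = 0) → x = 0) :
    ∃ k, ∀ x, x ∈ F ↔ ∀ i : {i // i ≠ k}, 0 ≤ b.coord i.1 x := by
  classical
  obtain ⟨i₀⟩ := ‹Nonempty ι›
  have hi₀ := basis_mem_of_mem_iff_coord_nonneg (f := id) hb i₀
  obtain ⟨v, hv, hψv⟩ := exists_forall_apply_eq_and_pos hψ hi₀.1 (b.ne_zero i₀)
  have hF_iff : ∀ {x}, x ∈ F ↔ ∀ i, b.coord i v = 0 → 0 ≤ b.coord i x :=
    hF.mem_iff_forall_coord_nonneg hb hv hψv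
  obtain ⟨k, hk⟩ : ∃ k, b.coord k v ≠ 0 := by
    by_contra! hzero
    have hv0 : v = 0 := b.ext_elem fun i => by simpa using hzero i
    exact hψv.ne' (hv0 ▸ map_zero ψ)
  have hcoord : ∀ i, b.coord i v = 0 → b.coord i (b k) = 0 := fun i hi => by
    rw [coord_apply_eq_ite, if_neg]
    rintro rfl
    exact hk hi
  have hbk : ∀ σ ∈ W, σ (b k) = b k := fun σ hσ => hF.apply_eq_of_neg_mem
    (hF_iff.mpr fun i hi => (hcoord i hi).ge)
    (hF_iff.mpr fun i hi => by rw [map_neg, hcoord i hi, neg_zero]) hσ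
  have hψbk : ψ (b k) ≠ 0 := fun h => b.ne_zero k (hψ _ fun σ hσ => (hbk σ hσ).symm ▸ h)
  have hv_iff : ∀ i, b.coord i v = 0 ↔ i ≠ k := fun i => by
    refine ⟨fun h hik => hk (hik ▸ h), fun hik => ?_⟩
    have hprop := congrArg (b.coord i) (smul_eq_smul_of_forall_apply_eq hψ hv hbk)
    rw [map_smul, map_smul, coord_apply_eq_ite, if_neg (Ne.symm hik), smul_zero] at hprop
    exact (smul_eq_zero_iff_right hψbk).mp hprop
  refine ⟨k, fun x => hF_iff.trans ?_⟩
  simp only [hv_iff, Subtype.forall]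

end SymmetricCones

section AlmostIrreducible

variable {V : Type*} [NormedAddCommGroup V] [InnerProductSpace ℝ V]
  {W : Subgroup (V ≃ₗᵢ[ℝ] V)} {V₁ V₂ : Submodule ℝ V}

namespace IsAlmostIrreducible

theorem nontrivial_space (h : IsAlmostIrreducible W V₁ V₂) : Nontrivial V := by
  obtain ⟨σ, -, x, -, hx⟩ := h.nontrivial
  exact nontrivial_of_ne _ _ hx

theorem mem_of_forall_apply_eq (h : IsAlmostIrreducible W V₁ V₂) {x : V}
    (hx : ∀ σ ∈ W, σ x = x) : x ∈ V₂ := by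
  obtain ⟨a, ha, c, hc, rfl⟩ :=
    Submodule.mem_sup.mp (h.isCompl.sup_eq_top ▸ Submodule.mem_top : x ∈ V₁ ⊔ V₂)
  have hfix : ∀ σ ∈ W, σ a = a := fun σ hσ => by
    simpa only [map_add, h.trivial σ hσ c hc, add_left_inj] using hx σ hσ
  have hfix_smul : ∀ d : ℝ, ∀ σ ∈ W, σ (d • a) = d • a := fun d σ hσ => by
    rw [map_smul, hfix σ hσ]
  have hinv : IsInvariant W (ℝ ∙ a) := fun σ hσ y hy => by
    obtain ⟨d, rfl⟩ := Submodule.mem_span_singleton.mp hy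
    rwa [hfix_smul d σ hσ]
  rcases h.irreducible (ℝ ∙ a) ((Submodule.span_singleton_le_iff_mem _ _).mpr ha) hinv with h0 | h0
  · rwa [Submodule.span_singleton_eq_bot.mp h0, zero_add]
  · obtain ⟨σ, hσ, y, hy, hne⟩ := h.nontrivial
    obtain ⟨d, rfl⟩ := Submodule.mem_span_singleton.mp (h0 ▸ hy)
    exact absurd (hfix_smul d σ hσ) hne

theorem apply_sub_self_mem (h : IsAlmostIrreducible W V₁ V₂) {σ : V ≃ₗᵢ[ℝ] V} (hσ : σ ∈ W)
    (x : V) : σ x - x ∈ V₁ := by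
  obtain ⟨a, ha, c, hc, rfl⟩ :=
    Submodule.mem_sup.mp (h.isCompl.sup_eq_top ▸ Submodule.mem_top : x ∈ V₁ ⊔ V₂)
  rw [map_add, h.trivial σ hσ c hc, add_sub_add_right_eq_sub]
  exact V₁.sub_mem (h.invariant σ hσ a ha) ha

theorem disjoint_ker (h : IsAlmostIrreducible W V₁ V₂) {ψ : Module.Dual ℝ V}
    (hψ₂ : ¬ V₂ ≤ LinearMap.ker ψ) : Disjoint V₂ (LinearMap.ker ψ) := by
  rw [Submodule.disjoint_def]
  intro x hx hψx
  by_contra hx0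
  refine hψ₂ fun y hy => ?_
  obtain ⟨c, hc⟩ := exists_smul_eq_of_finrank_eq_one h.finrank_eq_one
    (x := (⟨x, hx⟩ : V₂)) (fun h0 => hx0 (congrArg Subtype.val h0)) ⟨y, hy⟩
  rw [← show c • x = y from congrArg Subtype.val hc]
  exact Submodule.smul_mem _ c hψx

-- The subspace `U` of all `x` whose orbit lies in the kernel of `ψ` is invariant and meets `V₁`
-- trivially, and `σ x - x` lies in both for every `x` in `U`. Hence `U` is contained in `V₂`.
theorem eq_zero_of_forall_apply_eq_zero (h : IsAlmostIrreducible W V₁ V₂) {ψ : Module.Dual ℝ V}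
    (hψ₁ : ¬ V₁ ≤ LinearMap.ker ψ) (hψ₂ : ¬ V₂ ≤ LinearMap.ker ψ) {x : V}
    (hx : ∀ σ ∈ W, ψ (σ x) = 0) : x = 0 := by
  let U : Submodule ℝ V :=
    { carrier := {y | ∀ σ ∈ W, ψ (σ y) = 0}
      add_mem' := fun hy hz σ hσ => by rw [map_add, map_add, hy σ hσ, hz σ hσ, add_zero]
      zero_mem' := fun σ _ => by rw [map_zero, map_zero]
      smul_mem' := fun c y hy σ hσ => by rw [map_smul, map_smul, hy σ hσ, smul_zero] }
  have hinv : IsInvariant W U := fun σ hσ y hy τ hτ => hy (τ * σ) (W.mul_mem hτ hσ)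
  have hbot : U ⊓ V₁ = ⊥ := by
    refine (h.irreducible _ inf_le_right fun σ hσ y hy =>
      ⟨hinv σ hσ y hy.1, h.invariant σ hσ y hy.2⟩).resolve_right fun heq => hψ₁ fun y hy => ?_
    exact (inf_eq_right.mp heq hy) 1 W.one_mem
  have hxV₂ : x ∈ V₂ := h.mem_of_forall_apply_eq fun σ hσ => sub_eq_zero.mp <|
    (Submodule.eq_bot_iff _).mp hbot _
      ⟨U.sub_mem (hinv σ hσ x hx) hx, h.apply_sub_self_mem hσ x⟩
  exact (Submodule.disjoint_def.mp (h.disjoint_ker hψ₂)) x hxV₂ (hx 1 W.one_mem)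

end IsAlmostIrreducible

end AlmostIrreducible

section AdaptedGenerators

variable {V : Type*} [NormedAddCommGroup V] [InnerProductSpace ℝ V] [FiniteDimensional ℝ V]
  {F K : Set V} {Γ : Submodule ℤ V} [DiscreteTopology Γ] [IsZLattice ℝ Γ] {m r : ℕ}
  {H : Fin r → Submodule ℝ V}

theorem exists_equiv_comp_eq_of_range_eq {α β γ : Type*} {f : α → γ} {g : β → γ}
    (hf : Function.Injective f) (hg : Function.Injective g) (h : Set.range f = Set.range g) :
    ∃ e : α ≃ β, ∀ x, g (e x) = f x :=
  ⟨(Equiv.ofInjective f hf).trans ((Equiv.setCongr h).trans (Equiv.ofInjective g hg).symm),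
    fun _ => Equiv.apply_ofInjective_symm hg _⟩

theorem IsPrimitiveGenerators.exists_facet_eq_ker_coord {b : Fin m → V}
    (h : IsPrimitiveGenerators Γ K b) {k : Fin m}
    (hF : ∀ x, x ∈ F ↔ ∀ i : {i // i ≠ k}, 0 ≤ h.basis.coord i.1 x)
    (hH : Function.Injective H) (hHF : Set.range H = {L | IsFacetHyperplane F L}) :
    ∃ (b' : Fin (r + 1) → V) (h' : IsPrimitiveGenerators Γ K b'),
      (∀ j, H j = LinearMap.ker (h'.basis.coord j.castSucc)) ∧
      ∀ x, x ∈ F ↔ ∀ j : Fin r, 0 ≤ h'.basis.coord j.castSucc x := by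
  have hfacets : Set.range H =
      Set.range fun i : {i // i ≠ k} => LinearMap.ker (h.basis.coord i.1) := by
    rw [hHF]
    ext L
    constructor
    · intro hL
      obtain ⟨i, hi⟩ := hL.exists_eq_ker_coord hF
      exact ⟨i, hi.symm⟩
    · rintro ⟨i, rfl⟩
      exact isFacetHyperplane_ker_coord hF i
  obtain ⟨e, he⟩ := exists_equiv_comp_eq_of_range_eq hH
    ((ker_coord_injective h.basis).comp Subtype.val_injective) hfacets
  let e' : Fin (r + 1) ≃ Fin m :=
    finSuccEquivLast.trans (e.optionCongr.trans (Equiv.optionSubtypeNe k))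
  have hcoord : ∀ j : Fin r,
      (h.comp_equiv e').basis.coord j.castSucc = h.basis.coord (e j).1 := fun j => by
    ext x
    rw [h.basis_comp_equiv e', Module.Basis.coord_apply, Module.Basis.repr_reindex_apply]
    simp [e']
  refine ⟨b ∘ e', h.comp_equiv e', fun j => ?_, fun x => ?_⟩
  · rw [hcoord, ← he j]
    rfl
  · simp only [hcoord, hF, ← e.forall_congr_right]

end AdaptedGenerators

section SimplicialChambers

variable {V : Type*} [NormedAddCommGroup V] [InnerProductSpace ℝ V] [FiniteDimensional ℝ V]
  {W : Subgroup (V ≃ₗᵢ[ℝ] V)} [Finite W] {F : Set V} {ι : Type*} [Finite ι] {r : ℕ}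
  {f : Fin r → ι} {b : Module.Basis ι ℝ V}

theorem IsFundamentalDomain.exists_isSimpleSystem (hF : IsFundamentalDomain W F)
    (hFb : ∀ x, x ∈ F ↔ ∀ j, 0 ≤ b.coord (f j) x) :
    ∃ a : Fin r → V, IsSimpleSystem W F a ∧ (∀ j x, ⟪a j, x⟫ = b.coord (f j) x) ∧
      ∀ j, (ℝ ∙ a j)ᗮ = LinearMap.ker (b.coord (f j)) := by
  let a : Fin r → V := fun j =>
    (InnerProductSpace.toDual ℝ V).symm (LinearMap.toContinuousLinearMap (b.coord (f j)))
  have ha : ∀ j x, ⟪a j, x⟫ = b.coord (f j) x := fun j x =>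
    InnerProductSpace.toDual_symm_apply
  have hker : ∀ j, (ℝ ∙ a j)ᗮ = LinearMap.ker (b.coord (f j)) := fun j => by
    ext x
    rw [Submodule.mem_orthogonal_singleton_iff_inner_right, ha, LinearMap.mem_ker]
  have hfacet : ∀ j, IsFacetHyperplane F (ℝ ∙ a j)ᗮ := fun j =>
    (hker j).symm ▸ isFacetHyperplane_ker_coord hFb j
  refine ⟨a, ⟨fun j h0 => coord_ne_zero b (f j) ?_, fun j => (hfacet j).reflection_mem hF,
    by simpa only [ha] using hFb, fun j => (hfacet j).2⟩, ha, hker⟩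
  ext x
  rw [← ha, h0, inner_zero_left, LinearMap.zero_apply]

end SimplicialChambers

section HalfOpenCones

theorem summable_norm_prod_and_hasSum_prod {R : Type*} [NormedCommRing R] [CompleteSpace R]
    {n : ℕ} {κ : Fin n → Type*} {f : ∀ j, κ j → R} {a : Fin n → R}
    (hf : ∀ j, Summable fun k => ‖f j k‖) (ha : ∀ j, HasSum (f j) (a j)) :
    (Summable fun c : ∀ j, κ j => ‖∏ j, f j (c j)‖) ∧
      HasSum (fun c : ∀ j, κ j => ∏ j, f j (c j)) (∏ j, a j) := by
  induction n with
  | zero =>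
    simp only [Finset.univ_eq_empty, Finset.prod_empty]
    exact ⟨(hasSum_unique _).summable, hasSum_unique _⟩
  | succ n ih =>
    obtain ⟨hnorm, hsum⟩ := ih (fun j => hf j.succ) fun j => ha j.succ
    have hnorm_mul := (hf 0).mul_norm hnorm
    have hsummable_mul := hnorm_mul.of_norm
    have hsum_mul := (ha 0).mul hsum hsummable_mul
    rw [← (Fin.consEquiv κ).hasSum_iff, ← (Fin.consEquiv κ).summable_iff]
    simp only [Fin.prod_univ_succ, Function.comp_def, Fin.consEquiv_apply, Fin.cons_zero,
      Fin.cons_succ]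
    exact ⟨hnorm_mul, hsum_mul⟩

theorem hasSum_prod_pow {𝕜 : Type*} [NormedField 𝕜] [CompleteSpace 𝕜] {n : ℕ} {z : Fin n → 𝕜}
    (hz : ∀ j, ‖z j‖ < 1) :
    HasSum (fun c : Fin n → ℕ => ∏ j, z j ^ c j) (∏ j, (1 - z j))⁻¹ := by
  have hsummable : ∀ j, Summable fun k : ℕ => ‖z j ^ k‖ := fun j => by
    simpa only [norm_pow] using summable_geometric_of_lt_one (norm_nonneg _) (hz j)
  have hsum := (summable_norm_prod_and_hasSum_prod hsummable fun j =>
    hasSum_geometric_of_norm_lt_one (hz j)).2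
  rwa [Finset.prod_inv_distrib] at hsum

/-- The points of the half-open cone `{∑ j, t j • b j | t j > 0 for j ∈ D, t j ≥ 0 for j ∉ D}` that
are integral with respect to the generators `b`. -/
def halfOpenConePoints {V : Type*} [AddCommMonoid V] {n : ℕ} (b : Fin n → V)
    (D : Finset (Fin n)) : Set V :=
  Set.range fun c : Fin n → ℕ => ∑ j ∈ D, b j + ∑ j, c j • b j

theorem halfOpenConePoints_comp {V V' L : Type*} [AddCommMonoid V] [AddCommMonoid V']
    [FunLike L V V'] [AddMonoidHomClass L V V'] {n : ℕ} (f : L) (b : Fin n → V)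
    (D : Finset (Fin n)) :
    halfOpenConePoints (f ∘ b) D = f '' halfOpenConePoints b D := by
  rw [halfOpenConePoints, halfOpenConePoints, ← Set.range_comp]
  simp only [Function.comp_def, map_add, map_sum, map_nsmul]

variable {V : Type*} [NormedAddCommGroup V] [NormedSpace ℝ V] {n : ℕ}

theorem hasSum_exp_halfOpenConePoints {b : Fin n → V} (hb : LinearIndependent ℤ b)
    (D : Finset (Fin n)) {φ : V →L[ℝ] ℂ} (hφ : ∀ j, 0 < (φ (b j)).re) :
    HasSum (fun x : halfOpenConePoints b D => Complex.exp (-φ (x : V)))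
      ((∏ j ∈ D, Complex.exp (-φ (b j))) / ∏ j, (1 - Complex.exp (-φ (b j)))) := by
  have hinj : Function.Injective fun c : Fin n → ℕ => ∑ j ∈ D, b j + ∑ j, c j • b j := fun c c' h =>
    linearIndependent_iff_injective_fintypeLinearCombination.mp (hb.restrict_scalars' ℕ)
      (add_left_cancel h)
  have hexp : ∀ c : Fin n → ℕ, Complex.exp (-φ (∑ j ∈ D, b j + ∑ j, c j • b j)) =
      (∏ j ∈ D, Complex.exp (-φ (b j))) * ∏ j, Complex.exp (-φ (b j)) ^ c j := fun c => by
    simp only [map_add, map_sum, map_nsmul, neg_add, Complex.exp_add, ← Finset.sum_neg_distrib,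
      Complex.exp_sum, ← Complex.exp_nat_mul, nsmul_eq_mul, mul_neg]
  have hnorm : ∀ j, ‖Complex.exp (-φ (b j))‖ < 1 := fun j => by
    rw [Complex.norm_exp, Complex.neg_re, Real.exp_lt_one_iff, neg_lt_zero]
    exact hφ j
  refine (hinj.hasSum_range_iff (f := fun x => Complex.exp (-φ x))).mpr ?_
  simp only [Function.comp_def, hexp, div_eq_mul_inv]
  exact (hasSum_prod_pow hnorm).mul_left _

end HalfOpenCones

section CellDecomposition

variable {V : Type*} [NormedAddCommGroup V] [InnerProductSpace ℝ V] [FiniteDimensional ℝ V]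
  {Γ : Submodule ℤ V} [DiscreteTopology Γ] [IsZLattice ℝ Γ]

namespace IsPrimitiveGenerators

variable {K : Set V} {n : ℕ} {b : Fin n → V}

theorem coord_sum_add_sum_nsmul (h : IsPrimitiveGenerators Γ K b) (D : Finset (Fin n))
    (c : Fin n → ℕ) (i : Fin n) :
    h.basis.coord i (∑ j ∈ D, b j + ∑ j, c j • b j) = (if i ∈ D then 1 else 0) + c i := by
  simp only [map_add, map_sum, map_nsmul, h.coord_apply_eq_ite, Finset.sum_ite_eq', nsmul_eq_mul,
    mul_ite, mul_one, mul_zero, Finset.mem_univ, if_true]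

theorem mem_halfOpenConePoints_iff (h : IsPrimitiveGenerators Γ K b) {D : Finset (Fin n)} {x : V} :
    x ∈ halfOpenConePoints b D ↔ x ∈ K ∧ x ∈ Γ ∧ ∀ j ∈ D, h.basis.coord j x ≠ 0 := by
  constructor
  · rintro ⟨c, rfl⟩
    rw [h.mem_cone_iff, h.mem_lattice_iff]
    simp only [h.coord_sum_add_sum_nsmul]
    refine ⟨fun i => by positivity, fun i => ⟨(if i ∈ D then 1 else 0) + c i, by push_cast; rfl⟩,
      fun j hj => ?_⟩
    rw [if_pos hj]
    positivity
  · rintro ⟨hK, hΓ, hD⟩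
    choose k hk using h.mem_lattice_iff.mp hΓ
    have hk_le : ∀ i, (if i ∈ D then 1 else 0) ≤ k i := fun i => by
      have hk_nonneg : 0 ≤ k i := by exact_mod_cast hk i ▸ h.mem_cone_iff.mp hK i
      split_ifs with hi
      · have hk_ne : k i ≠ 0 := by exact_mod_cast hk i ▸ hD i hi
        lia
      · exact hk_nonneg
    refine ⟨fun i => (k i - if i ∈ D then 1 else 0).toNat, h.basis.ext_elem fun i => ?_⟩
    rw [← h.basis.coord_apply, ← h.basis.coord_apply, h.coord_sum_add_sum_nsmul, hk]
    have hnat := Int.toNat_of_nonneg (sub_nonneg.mpr (hk_le i))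
    rw [← Int.cast_natCast, hnat]
    push_cast
    ring

end IsPrimitiveGenerators

variable {W : Subgroup (V ≃ₗᵢ[ℝ] V)} {ψ : Module.Dual ℝ V} {F : Set V} {r : ℕ} {a : Fin r → V}
  {b : Fin (r + 1) → V} (hΓ : ∀ σ ∈ W, ∀ x ∈ Γ, σ x ∈ Γ)
  (hb : IsPrimitiveGenerators Γ (symmetricCone W ψ ∩ F) b)
  (hab : ∀ j x, ⟪a j, x⟫ = hb.basis.coord j.castSucc x)

include hΓ hab

theorem mem_halfOpenConePoints_rightDescents_iff {σ : V ≃ₗᵢ[ℝ] V} (hσ : σ ∈ W) {x : V} :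
    x ∈ halfOpenConePoints (σ ∘ b)
        ((rightDescents (fun i => (ℝ ∙ a i)ᗮ.reflection) σ).map Fin.castSuccEmb) ↔
      x ∈ symmetricCone W ψ ∩ Γ ∧ σ⁻¹ x ∈ F ∧
        ∀ j ∈ rightDescents (fun i => (ℝ ∙ a i)ᗮ.reflection) σ, ⟪a j, σ⁻¹ x⟫ ≠ 0 := by
  have hlattice : σ⁻¹ x ∈ Γ ↔ x ∈ Γ :=
    ⟨fun h => apply_inv_self σ x ▸ hΓ σ hσ _ h, hΓ _ (W.inv_mem hσ) x⟩
  have hpreimage : x ∈ σ '' halfOpenConePoints b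
        ((rightDescents (fun i => (ℝ ∙ a i)ᗮ.reflection) σ).map Fin.castSuccEmb) ↔
      σ⁻¹ x ∈ halfOpenConePoints b
        ((rightDescents (fun i => (ℝ ∙ a i)ᗮ.reflection) σ).map Fin.castSuccEmb) :=
    Set.mem_image_equiv (f := σ.toEquiv)
  rw [halfOpenConePoints_comp, hpreimage, hb.mem_halfOpenConePoints_iff, hlattice,
    Set.mem_inter_iff, apply_mem_symmetricCone_iff (W.inv_mem hσ)]
  simp only [Finset.forall_mem_map, Fin.castSuccEmb_apply, hab, Set.mem_inter_iff, SetLike.mem_coe]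
  tauto

theorem hasSum_exp_symmetricCone [Fintype W] (hF : IsFundamentalDomain W F)
    (ha : IsSimpleSystem W F a) {φ : V →L[ℝ] ℂ} (hφ : ∀ σ ∈ W, ∀ j, 0 < (φ (σ (b j))).re) :
    HasSum (fun x : ↥(symmetricCone W ψ ∩ (Γ : Set V)) => Complex.exp (-φ (x : V)))
      (∑ σ : W,
        (∏ j ∈ rightDescents (fun i => (ℝ ∙ a i)ᗮ.reflection) (σ : V ≃ₗᵢ[ℝ] V),
            Complex.exp (-φ ((σ : V ≃ₗᵢ[ℝ] V) (b j.castSucc)))) /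
          ∏ j, (1 - Complex.exp (-φ ((σ : V ≃ₗᵢ[ℝ] V) (b j))))) := by
  obtain ⟨p, hp⟩ := hF.interior_nonempty
  have hunique := ha.existsUnique_forall_inner_ne_zero hF hp
  let cell : W → Set V := fun σ => halfOpenConePoints ((σ : V ≃ₗᵢ[ℝ] V) ∘ b)
    ((rightDescents (fun i => (ℝ ∙ a i)ᗮ.reflection) (σ : V ≃ₗᵢ[ℝ] V)).map Fin.castSuccEmb)
  have hmem : ∀ (σ : W) {x}, x ∈ cell σ ↔ x ∈ symmetricCone W ψ ∩ Γ ∧ _ := fun σ _ =>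
    mem_halfOpenConePoints_rightDescents_iff hΓ hb hab σ.2
  have hcover : symmetricCone W ψ ∩ (Γ : Set V) = ⋃ σ ∈ Finset.univ, cell σ := by
    ext x
    simp only [Finset.mem_univ, Set.iUnion_true, Set.mem_iUnion, hmem, exists_and_left]
    exact (and_iff_left (hunique x).exists).symm
  have hdisjoint : ((Finset.univ : Finset W) : Set W).Pairwise (Function.onFun Disjoint cell) :=
    fun σ _ τ _ hne => Set.disjoint_left.mpr fun x hσ hτ =>
      hne ((hunique x).unique ((hmem σ).mp hσ).2 ((hmem τ).mp hτ).2)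
  rw [hcover]
  refine hasSum_sum_disjoint (f := fun x => Complex.exp (-φ x)) _ hdisjoint fun σ _ => ?_
  have hindep : LinearIndependent ℤ ((σ : V ≃ₗᵢ[ℝ] V) ∘ b) :=
    hb.linearIndependent.map' (σ : V ≃ₗᵢ[ℝ] V).toLinearEquiv.toAddEquiv.toIntLinearEquiv.toLinearMap
      (LinearEquiv.ker _)
  have hsum := hasSum_exp_halfOpenConePoints hindep
    ((rightDescents (fun i => (ℝ ∙ a i)ᗮ.reflection) (σ : V ≃ₗᵢ[ℝ] V)).map Fin.castSuccEmb)
    (hφ σ σ.2)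
  rwa [Finset.prod_map] at hsum

end CellDecomposition

section Meromorphic

variable {E : Type*} [NormedAddCommGroup E] [NormedSpace ℂ E]

theorem not_eventually_eq_zero {f : E → ℂ} (hf : AnalyticOnNhd ℂ f Set.univ) {z₀ : E}
    (hz₀ : f z₀ ≠ 0) (z : E) : ¬ ∀ᶠ w in 𝓝 z, f w = 0 := fun h =>
  hz₀ (hf.eqOn_zero_of_preconnected_of_eventuallyEq_zero isPreconnected_univ (Set.mem_univ z) h
    (Set.mem_univ z₀))

theorem isMeromorphic_sum_div {ι : Type*} {s : Finset ι} {N D : ι → E → ℂ}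
    (hN : ∀ i ∈ s, AnalyticOnNhd ℂ (N i) Set.univ) (hD : ∀ i ∈ s, AnalyticOnNhd ℂ (D i) Set.univ)
    {z₀ : E} (hz₀ : ∀ i ∈ s, D i z₀ ≠ 0) : IsMeromorphic fun z => ∑ i ∈ s, N i z / D i z := by
  classical
  have hprod : ∀ t ⊆ s, AnalyticOnNhd ℂ (fun z => ∏ i ∈ t, D i z) Set.univ := fun t ht =>
    Finset.analyticOnNhd_fun_prod t fun i hi => hD i (ht hi)
  intro z
  refine ⟨fun w => ∑ i ∈ s, N i w * ∏ k ∈ s.erase i, D k w, fun w => ∏ i ∈ s, D i w,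
    Finset.analyticAt_fun_sum s fun i hi => (hN i hi z (Set.mem_univ z)).mul
      (hprod _ (s.erase_subset i) z (Set.mem_univ z)),
    hprod s subset_rfl z (Set.mem_univ z),
    not_eventually_eq_zero (hprod s subset_rfl) (Finset.prod_ne_zero_iff.mpr hz₀) z,
    Eventually.of_forall fun w hw => ?_⟩
  simp only [Finset.sum_div]
  refine Finset.sum_congr rfl fun i hi => ?_
  rw [← Finset.mul_prod_erase s (fun i => D i w) hi, mul_div_mul_right]
  exact Finset.prod_ne_zero_iff.mpr fun k hk =>
    Finset.prod_ne_zero_iff.mp hw k (Finset.mem_of_mem_erase hk)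

variable {V : Type*} [NormedAddCommGroup V] [NormedSpace ℝ V]

/-- Evaluation at `v`, as a complex linear form on the complexified dual of `V`;
`ContinuousLinearMap.apply'` is only real linear in this situation. -/
noncomputable def evalCLM (v : V) : (V →L[ℝ] ℂ) →L[ℂ] ℂ where
  toFun φ := φ v
  map_add' _ _ := rfl
  map_smul' _ _ := rfl
  cont := by fun_prop

theorem analyticOnNhd_exp_neg_apply (v : V) :
    AnalyticOnNhd ℂ (fun φ : V →L[ℝ] ℂ => Complex.exp (-φ v)) Set.univ := fun φ _ =>
  ((evalCLM v).analyticAt φ).neg.cexp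

theorem isOpen_setOf_forall_re_pos {ι : Type*} [Finite ι] (v : ι → V) :
    IsOpen {φ : V →L[ℝ] ℂ | ∀ i, 0 < (φ (v i)).re} := by
  simp only [Set.ofPred_forall]
  exact isOpen_iInter_of_finite fun i => isOpen_lt continuous_const (by fun_prop)

end Meromorphic

section GeneratingFunction

variable {V : Type*} [NormedAddCommGroup V] [InnerProductSpace ℝ V] [FiniteDimensional ℝ V]
  {Γ : Submodule ℤ V} [DiscreteTopology Γ] [IsZLattice ℝ Γ] {W : Subgroup (V ≃ₗᵢ[ℝ] V)}
  {ψ : Module.Dual ℝ V} {F : Set V} {r : ℕ} {a : Fin r → V} {b : Fin (r + 1) → V}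

theorem exists_forall_re_apply_pos [Finite W] (hψ : ∀ x, (∀ σ ∈ W, ψ (σ x) = 0) → x = 0) :
    ∃ φ : V →L[ℝ] ℂ, ∀ x ∈ symmetricCone W ψ, x ≠ 0 → ∀ σ ∈ W, 0 < (φ (σ x)).re := by
  cases nonempty_fintype W
  let ψsum : Module.Dual ℝ V := ∑ τ : W, ψ ∘ₗ (τ : V ≃ₗᵢ[ℝ] V).toLinearEquiv.toLinearMap
  have hψsum : ∀ x, ψsum x = ∑ τ : W, ψ ((τ : V ≃ₗᵢ[ℝ] V) x) := fun x => by
    simp only [ψsum, LinearMap.sum_apply]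
    rfl
  refine ⟨Complex.ofRealCLM.comp (LinearMap.toContinuousLinearMap ψsum), fun x hx hx0 σ hσ => ?_⟩
  rw [ContinuousLinearMap.comp_apply, Complex.ofRealCLM_apply, Complex.ofReal_re,
    LinearMap.coe_toContinuousLinearMap', hψsum]
  exact sum_apply_pos_of_mem_symmetricCone hψ ((apply_mem_symmetricCone_iff hσ).mpr hx)
    ((map_ne_zero_iff σ σ.injective).mpr hx0)

theorem isGeneratingFunction_symmetricCone [Fintype W] (hΓ : ∀ σ ∈ W, ∀ x ∈ Γ, σ x ∈ Γ)
    (hψ : ∀ x, (∀ σ ∈ W, ψ (σ x) = 0) → x = 0) (hF : IsFundamentalDomain W F)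
    (ha : IsSimpleSystem W F a) (hb : IsPrimitiveGenerators Γ (symmetricCone W ψ ∩ F) b)
    (hab : ∀ j x, ⟪a j, x⟫ = hb.basis.coord j.castSucc x) :
    IsGeneratingFunction Γ (symmetricCone W ψ) (fun φ => ∑ σ : W,
      (∏ j ∈ rightDescents (fun i => (ℝ ∙ a i)ᗮ.reflection) (σ : V ≃ₗᵢ[ℝ] V),
          Complex.exp (-φ ((σ : V ≃ₗᵢ[ℝ] V) (b j.castSucc)))) /
        ∏ j, (1 - Complex.exp (-φ ((σ : V ≃ₗᵢ[ℝ] V) (b j))))) := by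
  obtain ⟨φ₀, hφ₀⟩ := exists_forall_re_apply_pos hψ
  have hpos : ∀ p : W × Fin (r + 1), 0 < (φ₀ ((p.1 : V ≃ₗᵢ[ℝ] V) (b p.2))).re := fun p =>
    hφ₀ _ (hb.mem_cone p.2).1 (hb.ne_zero p.2) _ p.1.2
  have hne : ∀ (σ : W) j, 1 - Complex.exp (-φ₀ ((σ : V ≃ₗᵢ[ℝ] V) (b j))) ≠ 0 := fun σ j =>
    sub_ne_zero.mpr fun h => by
      have hnorm := congrArg norm h
      rw [norm_one, Complex.norm_exp, eq_comm, Real.exp_eq_one_iff, Complex.neg_re] at hnorm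
      exact (neg_neg_of_pos (hpos (σ, j))).ne hnorm
  refine ⟨?_, _, isOpen_setOf_forall_re_pos fun p : W × Fin (r + 1) => (p.1 : V ≃ₗᵢ[ℝ] V) (b p.2),
    ⟨φ₀, hpos⟩, fun φ hφ => hasSum_exp_symmetricCone hΓ hb hab hF ha fun σ hσ j => hφ (⟨σ, hσ⟩, j)⟩
  exact isMeromorphic_sum_div
    (fun σ _ => Finset.analyticOnNhd_fun_prod _ fun j _ => analyticOnNhd_exp_neg_apply _)
    (fun σ _ => Finset.analyticOnNhd_fun_prod _ fun j _ =>
      analyticOnNhd_const.sub (analyticOnNhd_exp_neg_apply _))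
    fun σ _ => Finset.prod_ne_zero_iff.mpr fun j _ => hne σ j

end GeneratingFunction

end SymCone

open SymCone in
theorem mainTheorem1_general {V : Type*} [NormedAddCommGroup V] [InnerProductSpace ℝ V]
    [FiniteDimensional ℝ V] [Nontrivial V] (W : Subgroup (V ≃ₗᵢ[ℝ] V)) [Fintype W]
    (Γ : Submodule ℤ V) [DiscreteTopology Γ] [IsZLattice ℝ Γ] (hΓ : ∀ σ ∈ W, ∀ x ∈ Γ, σ x ∈ Γ)
    (ψ : Module.Dual ℝ V) (hψ : ∀ x, (∀ σ ∈ W, ψ (σ x) = 0) → x = 0)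
    (F : Set V) (hF : IsFundamentalDomain W F)
    {r : ℕ} (H : Fin r → Submodule ℝ V) (hH : Function.Injective H)
    (hHF : Set.range H = {L | IsFacetHyperplane F L})
    (hu : IsUnimodularCone Γ (symmetricCone W ψ ∩ F)) :
    (∃! b : Fin (r + 1) → V,
      IsPrimitiveGenerators Γ (symmetricCone W ψ ∩ F) b ∧ ∀ j : Fin r, b j.castSucc ∉ H j) ∧
    ∀ b : Fin (r + 1) → V,
      IsPrimitiveGenerators Γ (symmetricCone W ψ ∩ F) b → (∀ j : Fin r, b j.castSucc ∉ H j) →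
      IsGeneratingFunction Γ (symmetricCone W ψ) (fun φ =>
        ∑ σ : W,
          (∏ j ∈ rightDescents (fun i => (H i).reflection) (σ : V ≃ₗᵢ[ℝ] V),
              Complex.exp (-φ ((σ : V ≃ₗᵢ[ℝ] V) (b j.castSucc)))) /
            ∏ j : Fin (r + 1), (1 - Complex.exp (-φ ((σ : V ≃ₗᵢ[ℝ] V) (b j))))) := by
  obtain ⟨m, b₀, h₀⟩ := hu
  have : Nonempty (Fin m) := h₀.basis.index_nonempty
  obtain ⟨k, hFk⟩ := hF.exists_mem_iff_forall_coord_nonneg (fun _ => h₀.mem_cone_iff) hψ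
  obtain ⟨b, h, hHb, hFb⟩ := h₀.exists_facet_eq_ker_coord hFk hH hHF
  obtain ⟨a, ha, hab, hker⟩ := hF.exists_isSimpleSystem hFb
  obtain rfl : H = fun j => (ℝ ∙ a j)ᗮ := funext fun j => (hHb j).trans (hker j).symm
  have hunique : ∀ b', IsPrimitiveGenerators Γ (symmetricCone W ψ ∩ F) b' →
      (∀ j : Fin r, b' j.castSucc ∉ (ℝ ∙ a j)ᗮ) → b' = b := fun b' h' hb' =>
    h.eq_of_coord_ne_zero h' fun j hj => hb' j ((hker j).symm ▸ hj)
  have hbH : ∀ j : Fin r, b j.castSucc ∉ (ℝ ∙ a j)ᗮ := fun j hj => by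
    rw [hker, LinearMap.mem_ker, h.coord_apply_eq_ite, if_pos rfl] at hj
    exact one_ne_zero hj
  refine ⟨⟨b, ⟨h, hbH⟩, fun b' hb' => hunique b' hb'.1 hb'.2⟩, fun b' h' hb' => ?_⟩
  obtain rfl := hunique b' h' hb'
  exact isGeneratingFunction_symmetricCone hΓ hψ hF ha h' hab

theorem mainTheorem1 {V : Type*} [NormedAddCommGroup V] [InnerProductSpace ℝ V]
    [FiniteDimensional ℝ V]
    -- an almost irreducible finite reflection group
    (W : Subgroup (V ≃ₗᵢ[ℝ] V)) [Fintype W] (hW : SymCone.IsReflectionGroup W)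
    (V₁ V₂ : Submodule ℝ V) (hirr : SymCone.IsAlmostIrreducible W V₁ V₂)
    -- a `W`-invariant lattice
    (Γ : Submodule ℤ V) [DiscreteTopology Γ] [IsZLattice ℝ Γ]
    (hΓ : ∀ σ ∈ W, ∀ x ∈ Γ, σ x ∈ Γ)
    -- a monoconditional symmetric cone and a fundamental domain
    (C : Set V) (hC : SymCone.IsMonoconditional W V₁ V₂ C)
    (F : Set V) (hF : SymCone.IsFundamentalDomain W F)
    -- an enumeration of the facet hyperplanes of the fundamental domain
    {r : ℕ} (H : Fin r → Submodule ℝ V) (hH : Function.Injective H)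
    (hHF : Set.range H = {L | SymCone.IsFacetHyperplane F L})
    (hu : SymCone.IsUnimodularCone Γ (C ∩ F)) :
    (∃! b : Fin (r + 1) → V,
      SymCone.IsPrimitiveGenerators Γ (C ∩ F) b ∧ ∀ j : Fin r, b j.castSucc ∉ H j) ∧
    ∀ b : Fin (r + 1) → V,
      SymCone.IsPrimitiveGenerators Γ (C ∩ F) b → (∀ j : Fin r, b j.castSucc ∉ H j) →
      SymCone.IsGeneratingFunction Γ C (fun φ =>
        ∑ σ : W,
          (∏ j ∈ SymCone.rightDescents (fun i => (H i).reflection) (σ : V ≃ₗᵢ[ℝ] V),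
              Complex.exp (-φ ((σ : V ≃ₗᵢ[ℝ] V) (b j.castSucc)))) /
            ∏ j : Fin (r + 1),
              (1 - Complex.exp (-φ ((σ : V ≃ₗᵢ[ℝ] V) (b j))))) := by
  obtain ⟨ψ, hψ₁, hψ₂, rfl⟩ := hC
  have := hirr.nontrivial_space
  exact mainTheorem1_general W Γ hΓ ψ
    (fun _ => hirr.eq_zero_of_forall_apply_eq_zero hψ₁ hψ₂) F hF H hH hHF hu
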